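/- **Conventions.** $S^*=\bigsqcup_n S^n$ is the set of finite words over $S$ and $[n]=\{1,\dots,n\}$. A *structure category* $\Delta$ is a wide subcategory of the category of the finite ordinals $[n]$ and all functions between them, closed under coproducts $f_1+\dots+f_k$ and, for $\theta\colon[m]\to[n]$ in $\Delta$ and $k_1,\dots,k_n\in\mathbb N$, under the block maps $\theta'_{k_1,\dots,k_n}\colon[k_{\theta(1)}+\dots+k_{\theta(m)}]\to[k_1+\dots+k_n]$ sending the $x$-th element of the $i$-th block to the $x$-th element of the $\theta(i)$-th block. A *$\Delta$-multicategory* $C$ is a multicategory with maps $\theta_*\colon C(a_{\theta(1)}\cdots a_{\theta(m)},b)\to C(a_1\cdots a_n,b)$ for $\theta\in\Delta$ such that $\mathrm{id}_*=\mathrm{id}$, $(\tau\sigma)_*=\tau_*\sigma_*$, $g\circ(\sigma^1_*f_1,\dots,\sigma^n_*f_n)=(\sigma^1+\dots+\sigma^n)_*(g\circ(f_1,\dots,f_n))$ and $\tau_*(g)\circ(f_1,\dots,f_n)=(\tau'_{k_1,\dots,k_n})_*(g\circ(f_{\tau(1)},\dots,f_{\tau(m)}))$, where $k_i$ is the length of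 the source of $f_i$. $\mathbf{Set}$ is the multicategory whose multimorphisms $X_1\cdots X_n\to X$ are the functions $X_1\times\dots\times X_n\to X$, with $\theta_*(f)(x_1,\dots,x_n)=f(x_{\theta(1)},\dots,x_{\theta(m)})$; it is a $\Delta$-multicategory for every $\Delta$. A *context* over a set $V$ is a word over $V$ without repeated letters. A *context structure* on $V$ is a relation $R$ between contexts and words such that: (1) $cRc$ for each context $c$; (2) $cRv$ implies $\mathrm{Var}(v)\subseteq\mathrm{Var}(c)$; (3) $cRv^1\cdots v^n$ and $v^iRw^i$ for all $i$ imply $cRw^1\cdots w^n$; (4) $cRv$, $s\colon\mathrm{Var}(c)\to V^*$ and $dRs(c)$ imply $dRs(v)$. It is *modelable* if $cRv^1\cdots v^n$ implies that there are contexts $c^i$ with $cRc^1\cdots c^n$ and $c^iRv^i$; *balanced* if $cRv$ implies $\mathrm{Var}(c)=\mathrm{Var}(v)$; *cartesian* if $cRv\iff\mathrm{Var}(v)\subseteq\mathrm{Var}(c)$ for all contexts $c$ and words $v$. A context $c$ is a *terminal context* of $v$ if $wRc\iff wRv$ for all contexts $w$; $R$ *has terminal contexts* if every word $v$ with $cRv$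 for some $c$ has one. For infinite $V$, $\Delta_R$ is the structure category of all $\theta\colon[m]\to[n]$ with $c_1\cdots c_nRc_{\theta(1)}\cdots c_{\theta(m)}$ for contexts $c_1\cdots c_n$ of length $n$. A *signature* $\sigma$ has a set of sorts, function symbols $f\colon a_1\cdots a_n\to b$ and, for each sort, countably infinitely many variables; $V$ is the set of all variables. Terms are built from variables and function symbols; $\tau(t)$ is the word of variables occurring in $t$ from left to right, and $v$ is an $R$-context of $t$ if $vR\tau(t)$. An *$R$-equation* $t_1\approx_vt_2$ consists of two terms of the same sort with a common $R$-context $v$; an *$R$-theory* is a set of $R$-equations. A *$\sigma$-model* $m$ in $C$ assigns an object $m(s)$ to each sort and a multimorphism $m(f)\colon m(a_1)\cdots m(a_n)\to m(b)$ to each function symbol. Let $R$ be modelable and $C$ a $\Delta_R$-multicategory. Write $m_v=m(s_1)\cdots m(s_n)$ for $v=x_1\cdots x_n$ with $x_i$ of sort $s_i$ and, for $vRw$ with $w=v_{\theta(1)}\cdots v_{\theta(k)}$, write $f*m_{v,w}=\theta_*(f)$. A term $t$ of sort $b$ with $R$-context $v$ has the interpretation $m_v(t)\colon m_v\to m(b)$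 given by $m_v(x)=\mathrm{id}*m_{v,x}$ and $m_v(f(t_1,\dots,t_k))=(m(f)\circ(m_{w_1}(t_1),\dots,m_{w_k}(t_k)))*m_{v,w_1\cdots w_k}$, where the $w_i$ are $R$-contexts of the $t_i$ with $vRw_1\cdots w_k$ (the result does not depend on their choice). The model satisfies $t_1\approx_vt_2$ if $m_v(t_1)=m_v(t_2)$, and $E\vDash_C\phi$ means that every $\sigma$-model in $C$ satisfying all equations of $E$ satisfies $\phi$. **Multi-Categorical Meta-Theorem.** (a) Let $\sigma$ be a signature with a modelable context structure $R$ on its set of variables, and suppose that $R$ is either balanced with terminal contexts, or cartesian. Let $E\cup\{\phi\}$ be an $R$-theory. If $E\vDash_{\mathbf{Set}}\phi$, then $E\vDash_C\phi$ for every $\Delta_R$-multicategory $C$. (b) This covers six kinds of multicategories: on every infinite set $V$, each of the following classes is $\Delta_R$ for some context structure $R$ on $V$ satisfying the hypotheses of (a): identities; bijections; all functions; surjections; left surjections (surjections $\theta$ with $\min\theta^{-1}\{i\}\le\min\theta^{-1}\{j\}$ for $i\le j$); right surjections (surjections $\theta$ with $\max\theta^{-1}\{i\}\le\max\theta^{-1}\{j\}$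 for $i\le j$). -/

import Mathlib

universe u v w

/-! ### Finite words -/

/-- A finite word `a₁ ⋯ aₙ` over `A`, that is, an element of `A* = ⨆ₙ Aⁿ`. -/
structure Word (A : Type u) where
  len : ℕ
  get : Fin len → A

namespace Word

variable {A : Type u} {B : Type v}

theorem ext_get {a b : Word A} (h : a.len = b.len)
    (hg : ∀ i, a.get i = b.get (Fin.cast h i)) : a = b := by
  obtain ⟨n, a⟩ := a
  obtain ⟨m, b⟩ := b
  obtain rfl : n = m := h
  obtain rfl : a = b := funext hg
  rfl

/-- The one-letter word. -/
def single (x : A) : Word A := ⟨1, fun _ => x⟩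

/-- The word `f(a₁) ⋯ f(aₙ)`. -/
def map (f : A → B) (a : Word A) : Word B := ⟨a.len, fun i => f (a.get i)⟩

/-- The word `a_{θ(1)} ⋯ a_{θ(m)}`. -/
def pull (a : Word A) {m : ℕ} (θ : Fin m → Fin a.len) : Word A := ⟨m, fun j => a.get (θ j)⟩

/-- The concatenation `w¹ ⋯ wⁿ` of `n` words. The equivalence `finSigmaFinEquiv` lists the pairs
`(i, j)` in lexicographic order. -/
def concat {n : ℕ} (w : Fin n → Word A) : Word A :=
  ⟨∑ i, (w i).len,
    fun p => (w (finSigmaFinEquiv.symm p).1).get (finSigmaFinEquiv.symm p).2⟩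

/-- The letter `x` is expressed in the word `a`. -/
def Mem (x : A) (a : Word A) : Prop := ∃ i, a.get i = x

/-- The set of letters expressed in a word. -/
def vars (a : Word A) : Set A := {x | a.Mem x}

/-- No letter of the word repeats. -/
def Nodup (a : Word A) : Prop := Function.Injective a.get

end Word

/-! ### Functions between finite ordinals -/

/-- The coproduct `f₁ + ⋯ + f_k` of functions between finite ordinals. -/
def finCoprod {k : ℕ} {m n : Fin k → ℕ} (f : ∀ i, Fin (m i) → Fin (n i)) :
    Fin (∑ i, m i) → Fin (∑ i, n i) :=
  fun p => finSigmaFinEquiv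
    ⟨(finSigmaFinEquiv.symm p).1, f (finSigmaFinEquiv.symm p).1 (finSigmaFinEquiv.symm p).2⟩

/-- The component `θ'_{k₁,…,kₙ} : [k_{θ(1)} + ⋯ + k_{θ(m)}] → [k₁ + ⋯ + kₙ]` of the similarity
of `θ`: the `x`-th element of the `i`-th block goes to the `x`-th element of the
`θ(i)`-th block. -/
def finSimilarity {m n : ℕ} (θ : Fin m → Fin n) (k : Fin n → ℕ) :
    Fin (∑ i, k (θ i)) → Fin (∑ j, k j) :=
  fun p => finSigmaFinEquiv
    ⟨θ (finSigmaFinEquiv.symm p).1, (finSigmaFinEquiv.symm p).2⟩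

theorem finCoprod_mk {k : ℕ} {m n : Fin k → ℕ} (f : ∀ i, Fin (m i) → Fin (n i)) (i : Fin k)
    (x : Fin (m i)) : finCoprod f (finSigmaFinEquiv ⟨i, x⟩) = finSigmaFinEquiv ⟨i, f i x⟩ :=
  congrArg (fun q : (i : Fin k) × Fin (m i) =>
      (finSigmaFinEquiv ⟨q.1, f q.1 q.2⟩ : Fin (∑ i, n i)))
    (Equiv.symm_apply_apply finSigmaFinEquiv (⟨i, x⟩ : (i : Fin k) × Fin (m i)))

theorem finSimilarity_mk {m n : ℕ} (θ : Fin m → Fin n) (k : Fin n → ℕ) (i : Fin m)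
    (x : Fin (k (θ i))) :
    finSimilarity θ k (finSigmaFinEquiv ⟨i, x⟩) = finSigmaFinEquiv ⟨θ i, x⟩ :=
  congrArg (fun q : (i : Fin m) × Fin (k (θ i)) =>
      (finSigmaFinEquiv ⟨θ q.1, q.2⟩ : Fin (∑ j, k j)))
    (Equiv.symm_apply_apply finSigmaFinEquiv (⟨i, x⟩ : (i : Fin m) × Fin (k (θ i))))

/-- A structure category: a wide subcategory of the category of finite ordinals and functions
that is closed under coproducts and under components of similarities. -/
structure StructureCategory where
  mem : ∀ {m n : ℕ}, (Fin m → Fin n) → Prop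
  id_mem : ∀ n : ℕ, mem (id : Fin n → Fin n)
  comp_mem : ∀ {k m n : ℕ} {τ : Fin m → Fin n} {σ : Fin k → Fin m},
    mem τ → mem σ → mem (τ ∘ σ)
  coprod_mem : ∀ {k : ℕ} {m n : Fin k → ℕ} {f : ∀ i, Fin (m i) → Fin (n i)},
    (∀ i, mem (f i)) → mem (finCoprod f)
  similarity_mem : ∀ {m n : ℕ} {θ : Fin m → Fin n} (k : Fin n → ℕ),
    mem θ → mem (finSimilarity θ k)

/-! ### Helper facts on concatenation -/

namespace Word

variable {A : Type u} {B : Type v}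

theorem concat_get_mk {n : ℕ} (w : Fin n → Word A) (i : Fin n) (j : Fin (w i).len) :
    (concat w).get (finSigmaFinEquiv ⟨i, j⟩) = (w i).get j := by
  have key : ∀ q : (i : Fin n) × Fin (w i).len, q = ⟨i, j⟩ →
      (w q.1).get q.2 = (w i).get j := by
    rintro _ rfl
    rfl
  exact key _ (Equiv.symm_apply_apply _ _)

theorem concat_get_coprod {n : ℕ} {a' a : Fin n → Word A}
    (σ : ∀ i, Fin (a' i).len → Fin (a i).len)
    (h : ∀ i j, (a' i).get j = (a i).get (σ i j)) (p : Fin (concat a').len) :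
    (concat a').get p = (concat a).get (finCoprod σ p) :=
  (h _ _).trans (concat_get_mk a _ _).symm

theorem concat_get_similarity {m n : ℕ} (a : Fin n → Word A) (θ : Fin m → Fin n)
    (p : Fin (concat fun j => a (θ j)).len) :
    (concat fun j => a (θ j)).get p
      = (concat a).get (finSimilarity θ (fun i => (a i).len) p) :=
  (concat_get_mk a _ _).symm

theorem finSigma_lt_of_fst {n : ℕ} {k : Fin n → ℕ} {x y : (i : Fin n) × Fin (k i)}
    (h : x.1 < y.1) : finSigmaFinEquiv x < finSigmaFinEquiv y := by
  have hs : ∀ i : Fin n, (∑ j : Fin i.1, k (Fin.castLE i.2.le j))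
      = ∑ j ∈ Finset.range i.1, (if hj : j < n then k ⟨j, hj⟩ else 0) := by
    intro i
    rw [Finset.sum_range]
    refine Finset.sum_congr rfl fun j _ => ?_
    rw [dif_pos (j.2.trans i.2)]
    rfl
  rw [Fin.lt_def, finSigmaFinEquiv_apply, finSigmaFinEquiv_apply, hs, hs]
  have h1 : (∑ j ∈ Finset.range (x.1.1 + 1), (if hj : j < n then k ⟨j, hj⟩ else 0))
      ≤ ∑ j ∈ Finset.range y.1.1, (if hj : j < n then k ⟨j, hj⟩ else 0) :=
    Finset.sum_le_sum_of_subset (Finset.range_mono h)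
  rw [Finset.sum_range_succ, dif_pos x.1.2] at h1
  have h2 : x.2.1 < k ⟨x.1.1, x.1.2⟩ := x.2.2
  omega

theorem finSigma_lt_of_snd {n : ℕ} {k : Fin n → ℕ} {i : Fin n} {x y : Fin (k i)}
    (h : x < y) :
    (finSigmaFinEquiv ⟨i, x⟩ : Fin (∑ i, k i)) < finSigmaFinEquiv ⟨i, y⟩ := by
  rw [Fin.lt_def, finSigmaFinEquiv_apply, finSigmaFinEquiv_apply]
  simpa using h

theorem fin_val_eq_of_strictMono {N N' : ℕ} (hN : N = N') (e : Fin N → Fin N')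
    (h : StrictMono e) (p : Fin N) : (e p : ℕ) = p := by
  subst hN
  have hs : Function.Surjective e := Finite.surjective_of_injective h.injective
  have := Subsingleton.elim (h.orderIsoOfSurjective e hs) (OrderIso.refl (Fin N))
  have h2 := congrArg (fun f : Fin N ≃o Fin N => f p) this
  exact congrArg Fin.val h2

theorem finSigma_lt_cases {n : ℕ} {k : Fin n → ℕ} {p q : Fin (∑ i, k i)} (h : p < q) :
    (finSigmaFinEquiv.symm p).1 < (finSigmaFinEquiv.symm q).1 ∨
      ∃ (i : Fin n) (x y : Fin (k i)), x < y ∧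
        finSigmaFinEquiv.symm p = ⟨i, x⟩ ∧ finSigmaFinEquiv.symm q = ⟨i, y⟩ := by
  obtain ⟨⟨i, x⟩, rfl⟩ := finSigmaFinEquiv.surjective p
  obtain ⟨⟨i', y⟩, rfl⟩ := finSigmaFinEquiv.surjective q
  simp only [Equiv.symm_apply_apply]
  rcases lt_trichotomy i i' with h' | rfl | h'
  · exact Or.inl h'
  · refine Or.inr ⟨i, x, y, ?_, rfl, rfl⟩
    by_contra hx
    rcases (not_lt.mp hx).lt_or_eq with h2 | h2
    · exact absurd h (finSigma_lt_of_snd h2).not_gt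
    · simp [h2] at h
  · exact absurd h (finSigma_lt_of_fst (x := ⟨i', y⟩) (y := ⟨i, x⟩) h').not_gt

/-- The comparison between the two ways of listing triples lexicographically. -/
def finAssoc {n : ℕ} {m : Fin n → ℕ} (k : ∀ i, Fin (m i) → ℕ) :
    Fin (∑ p : Fin (∑ i, m i), k (finSigmaFinEquiv.symm p).1 (finSigmaFinEquiv.symm p).2) →
      Fin (∑ i, ∑ j, k i j) :=
  fun p => finSigmaFinEquiv ⟨(finSigmaFinEquiv.symm (finSigmaFinEquiv.symm p).1).1,
    finSigmaFinEquiv ⟨(finSigmaFinEquiv.symm (finSigmaFinEquiv.symm p).1).2,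
      (finSigmaFinEquiv.symm p).2⟩⟩

theorem finAssoc_strictMono {n : ℕ} {m : Fin n → ℕ} (k : ∀ i, Fin (m i) → ℕ) :
    StrictMono (finAssoc k) := by
  intro p q h
  rcases finSigma_lt_cases h with h1 | ⟨a, x, y, hxy, hp, hq⟩
  · rcases finSigma_lt_cases h1 with h2 | ⟨i, x, y, hxy, hp, hq⟩
    · exact finSigma_lt_of_fst h2
    · have aux : ∀ (s t : (i : Fin n) × Fin (m i)) (u : Fin (k s.1 s.2)) (v : Fin (k t.1 t.2)),
          s = ⟨i, x⟩ → t = ⟨i, y⟩ →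
          (finSigmaFinEquiv ⟨s.1, finSigmaFinEquiv ⟨s.2, u⟩⟩ : Fin (∑ i, ∑ j, k i j))
            < finSigmaFinEquiv ⟨t.1, finSigmaFinEquiv ⟨t.2, v⟩⟩ := by
        rintro _ _ u v rfl rfl
        exact finSigma_lt_of_snd (finSigma_lt_of_fst hxy)
      exact aux _ _ _ _ hp hq
  · have aux : ∀ s t : (p : Fin (∑ i, m i)) ×
          Fin (k (finSigmaFinEquiv.symm p).1 (finSigmaFinEquiv.symm p).2),
        s = ⟨a, x⟩ → t = ⟨a, y⟩ →
        (finSigmaFinEquiv ⟨(finSigmaFinEquiv.symm s.1).1,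
          finSigmaFinEquiv ⟨(finSigmaFinEquiv.symm s.1).2, s.2⟩⟩ : Fin (∑ i, ∑ j, k i j))
          < finSigmaFinEquiv ⟨(finSigmaFinEquiv.symm t.1).1,
            finSigmaFinEquiv ⟨(finSigmaFinEquiv.symm t.1).2, t.2⟩⟩ := by
      rintro _ _ rfl rfl
      exact finSigma_lt_of_snd (finSigma_lt_of_snd hxy)
    exact aux _ _ hp hq

theorem finAssoc_card {n : ℕ} {m : Fin n → ℕ} (k : ∀ i, Fin (m i) → ℕ) :
    (∑ p : Fin (∑ i, m i), k (finSigmaFinEquiv.symm p).1 (finSigmaFinEquiv.symm p).2)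
      = ∑ i, ∑ j, k i j := by
  rw [Equiv.sum_comp finSigmaFinEquiv.symm
    (fun q : (i : Fin n) × Fin (m i) => k q.1 q.2), Fintype.sum_sigma]

theorem finAssoc_eq_cast {n : ℕ} {m : Fin n → ℕ} (k : ∀ i, Fin (m i) → ℕ) :
    finAssoc k = Fin.cast (finAssoc_card k) :=
  funext fun p => Fin.ext
    (fin_val_eq_of_strictMono (finAssoc_card k) _ (finAssoc_strictMono k) p)

/-- Concatenation is associative. -/
theorem concat_concat {n : ℕ} (b : Fin n → Word B)
    (a : ∀ i, Fin (b i).len → Word A) :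
    concat (fun p : Fin (concat b).len =>
        a (finSigmaFinEquiv.symm p).1 (finSigmaFinEquiv.symm p).2)
      = concat fun i => concat (a i) := by
  refine ext_get (finAssoc_card fun i j => (a i j).len) fun p => ?_
  have := congrFun (finAssoc_eq_cast fun i j => (a i j).len) p
  refine Eq.trans ?_ (congrArg (concat fun i => concat (a i)).get this)
  exact ((concat_get_mk (fun i => concat (a i)) _ (finSigmaFinEquiv ⟨_, _⟩)).trans
    (concat_get_mk (a _) _ _)).symm

/-- Concatenating one-letter words. -/
theorem concat_single (a : Word A) : concat (fun i => single (a.get i)) = a := by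
  have hc : (∑ _i : Fin a.len, 1) = a.len := by simp
  have hm : StrictMono
      (fun p : Fin (∑ _i : Fin a.len, 1) => (finSigmaFinEquiv.symm p).1) := by
    intro p q h
    rcases finSigma_lt_cases h with h1 | ⟨i, x, y, hxy, -, -⟩
    · exact h1
    · exact absurd hxy (by rw [Subsingleton.elim x y]; exact lt_irrefl y)
  refine ext_get hc fun p => congrArg a.get (Fin.ext ?_)
  exact fin_val_eq_of_strictMono hc _ hm p

theorem finSigma_one_val {n : ℕ} (i : Fin n) :
    ((finSigmaFinEquiv (⟨i, 0⟩ : (_ : Fin n) × Fin 1) : Fin (∑ _i : Fin n, 1)) : ℕ) = i := by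
  rw [finSigmaFinEquiv_apply]
  simp

/-- Concatenating a single word. -/
theorem concat_one (a : Word A) : concat (fun _ : Fin 1 => a) = a := by
  have hc : (∑ _i : Fin 1, a.len) = a.len := by simp
  have hm : StrictMono
      (fun p : Fin (∑ _i : Fin 1, a.len) => (finSigmaFinEquiv.symm p).2) := by
    intro p q h
    rcases finSigma_lt_cases h with h1 | ⟨i, x, y, hxy, hp, hq⟩
    · exact absurd h1 (by
        rw [Subsingleton.elim (finSigmaFinEquiv.symm p).1 (finSigmaFinEquiv.symm q).1]
        exact lt_irrefl _)
    · simpa only [hp, hq] using hxy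
  refine ext_get hc fun p => congrArg a.get (Fin.ext ?_)
  exact fin_val_eq_of_strictMono hc _ hm p

end Word

/-! ### `Δ`-multicategories -/

/-- A `Δ`-multicategory. The map `θ_* : C(a_{θ(1)} ⋯ a_{θ(m)}, b) → C(a₁ ⋯ aₙ, b)` is written
`act θ`; the source word `a'` is `a_{θ(1)} ⋯ a_{θ(m)}` by the hypothesis `ha`. The heterogeneous equalities in the
associativity and identity laws are equalities of multimorphisms whose source words are equal
(`Word.concat_concat`, `Word.concat_single`, `Word.concat_one`). -/
structure Multicategory (Δ : StructureCategory) where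
  Obj : Type v
  Hom : Word Obj → Obj → Type w
  comp : ∀ {b : Word Obj} {c : Obj}, Hom b c →
    ∀ {a : Fin b.len → Word Obj}, (∀ i, Hom (a i) (b.get i)) → Hom (Word.concat a) c
  one : ∀ a : Obj, Hom (Word.single a) a
  act : ∀ {a' a : Word Obj} {b : Obj} (θ : Fin a'.len → Fin a.len), Δ.mem θ →
    (∀ j, a'.get j = a.get (θ j)) → Hom a' b → Hom a b
  assoc : ∀ {c : Word Obj} {d : Obj} (h : Hom c d) {b : Fin c.len → Word Obj}
    (g : ∀ i, Hom (b i) (c.get i)) {a : ∀ i, Fin (b i).len → Word Obj}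
    (f : ∀ i j, Hom (a i j) ((b i).get j)),
    HEq (comp (comp h g) (a := fun p => a (finSigmaFinEquiv.symm p).1 (finSigmaFinEquiv.symm p).2)
          (fun p => f (finSigmaFinEquiv.symm p).1 (finSigmaFinEquiv.symm p).2))
      (comp h (fun i => comp (g i) (f i)))
  comp_one : ∀ {a : Word Obj} {b : Obj} (f : Hom a b),
    HEq (comp f (fun i => one (a.get i))) f
  one_comp : ∀ {a : Word Obj} {b : Obj} (f : Hom a b),
    HEq (comp (one b) (a := fun _ => a) (fun _ => f)) f
  act_id : ∀ {a : Word Obj} {b : Obj} (f : Hom a b),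
    act id (Δ.id_mem a.len) (fun _ => rfl) f = f
  act_act : ∀ {a'' a' a : Word Obj} {b : Obj} (τ : Fin a'.len → Fin a.len) (hτ : Δ.mem τ)
    (σ : Fin a''.len → Fin a'.len) (hσ : Δ.mem σ)
    (ha : ∀ j, a'.get j = a.get (τ j)) (ha' : ∀ j, a''.get j = a'.get (σ j)) (f : Hom a'' b),
    act (τ ∘ σ) (Δ.comp_mem hτ hσ) (fun j => (ha' j).trans (ha (σ j))) f
      = act τ hτ ha (act σ hσ ha' f)
  comp_act : ∀ {b : Word Obj} {c : Obj} (g : Hom b c) {a' a : Fin b.len → Word Obj}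
    (σ : ∀ i, Fin (a' i).len → Fin (a i).len) (hσ : ∀ i, Δ.mem (σ i))
    (ha : ∀ i j, (a' i).get j = (a i).get (σ i j)) (f : ∀ i, Hom (a' i) (b.get i)),
    comp g (fun i => act (σ i) (hσ i) (ha i) (f i))
      = act (finCoprod σ) (Δ.coprod_mem hσ) (Word.concat_get_coprod σ ha) (comp g f)
  act_comp : ∀ {b : Word Obj} {c : Obj} {m : ℕ} (τ : Fin m → Fin b.len) (hτ : Δ.mem τ)
    (g : Hom (b.pull τ) c) {a : Fin b.len → Word Obj} (f : ∀ i, Hom (a i) (b.get i)),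
    comp (act τ hτ (fun _ => rfl) g) f
      = act (finSimilarity τ fun i => (a i).len) (Δ.similarity_mem _ hτ)
          (Word.concat_get_similarity a τ) (comp g (fun j => f (τ j)))

/-! ### The multicategory of sets -/

namespace SetMulticategory

/-- Multimorphisms `X₁ ⋯ Xₙ → X` are functions `X₁ × ⋯ × Xₙ → X`. -/
def Hom (a : Word (Type u)) (b : Type u) : Type u := (∀ i, a.get i) → b

/-- The `i`-th block of a tuple indexed by a concatenation of words. -/
def block {n : ℕ} {a : Fin n → Word (Type u)} (x : ∀ p, (Word.concat a).get p) (i : Fin n)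
    (j : Fin (a i).len) : (a i).get j :=
  cast (Word.concat_get_mk a i j) (x (finSigmaFinEquiv ⟨i, j⟩))

/-- The tuple `(x_{θ(1)}, …, x_{θ(m)})`. -/
def restrict {a' a : Word (Type u)} (θ : Fin a'.len → Fin a.len)
    (ha : ∀ j, a'.get j = a.get (θ j)) (x : ∀ i, a.get i) (j : Fin a'.len) : a'.get j :=
  cast (ha j).symm (x (θ j))

theorem tuple_heq {a : Word (Type u)} (x : ∀ i, a.get i) {i j : Fin a.len} (h : i = j) :
    HEq (x i) (x j) := by
  subst h
  rfl

theorem block_heq {n : ℕ} {a : Fin n → Word (Type u)} (x : ∀ p, (Word.concat a).get p)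
    (i : Fin n) (j : Fin (a i).len) : HEq (block x i j) (x (finSigmaFinEquiv ⟨i, j⟩)) :=
  cast_heq _ _

theorem restrict_heq {a' a : Word (Type u)} (θ : Fin a'.len → Fin a.len)
    (ha : ∀ j, a'.get j = a.get (θ j)) (x : ∀ i, a.get i) (j : Fin a'.len) :
    HEq (restrict θ ha x j) (x (θ j)) :=
  cast_heq _ _

theorem hom_heq {a a' : Word (Type u)} {b : Type u} (h : a = a') (f : Hom a b) (f' : Hom a' b)
    (H : ∀ (x : ∀ i, a.get i) (x' : ∀ i, a'.get i),
      (∀ (i : Fin a.len) (i' : Fin a'.len), (i : ℕ) = i' → HEq (x i) (x' i')) → f x = f' x') :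
    HEq f f' := by
  subst h
  refine heq_of_eq (funext fun x => H x x fun i i' hi => ?_)
  exact tuple_heq x (Fin.ext hi)

end SetMulticategory

open SetMulticategory in
/-- The cartesian multicategory of sets, with its action restricted to `Δ`. -/
def setMulticategory (Δ : StructureCategory) : Multicategory.{u + 1, u} Δ where
  Obj := Type u
  Hom := SetMulticategory.Hom
  comp g _ f := fun x => g fun i => f i (block x i)
  one _ := fun x => x (0 : Fin 1)
  act θ _ ha f := fun x => f (restrict θ ha x)
  assoc {c d} h {b} g {a} f := by
    refine hom_heq (Word.concat_concat b a) _ _ fun x x' hx => ?_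
    refine congrArg h (funext fun i => congrArg (g i) (funext fun j => ?_))
    have h1 : ∀ p : Fin (Word.concat b).len,
        f (finSigmaFinEquiv.symm p).1 (finSigmaFinEquiv.symm p).2 (block x p)
          = f (finSigmaFinEquiv.symm p).1 (finSigmaFinEquiv.symm p).2
            (block (block x' (finSigmaFinEquiv.symm p).1) (finSigmaFinEquiv.symm p).2) := by
      intro p
      refine congrArg (f _ _) (funext fun k => eq_of_heq ?_)
      refine (block_heq x p k).trans (HEq.trans ?_ ((block_heq _ _ _).trans (block_heq _ _ _)).symm)
      refine hx _ _ ?_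
      have h3 := congrFun (Word.finAssoc_eq_cast fun i j => (a i j).len)
        (finSigmaFinEquiv ⟨p, k⟩)
      have h4 := congrArg Fin.val h3
      refine h4.symm.trans ?_
      have h5 : ∀ q : (p : Fin (∑ i, (b i).len)) ×
          Fin (a (finSigmaFinEquiv.symm p).1 (finSigmaFinEquiv.symm p).2).len, q = ⟨p, k⟩ →
          ((finSigmaFinEquiv ⟨(finSigmaFinEquiv.symm q.1).1,
            finSigmaFinEquiv ⟨(finSigmaFinEquiv.symm q.1).2, q.2⟩⟩ :
              Fin (∑ i, ∑ j, (a i j).len)) : ℕ)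
          = ((finSigmaFinEquiv ⟨(finSigmaFinEquiv.symm p).1,
            finSigmaFinEquiv ⟨(finSigmaFinEquiv.symm p).2, k⟩⟩ :
              Fin (∑ i, ∑ j, (a i j).len)) : ℕ) := by
        rintro _ rfl
        rfl
      exact h5 _ (Equiv.symm_apply_apply _ _)
    have h2 : ∀ q : (i : Fin c.len) × Fin (b i).len, q = ⟨i, j⟩ →
        HEq (f q.1 q.2 (block (block x' q.1) q.2)) (f i j (block (block x' i) j)) := by
      rintro _ rfl
      rfl
    refine eq_of_heq ((block_heq _ i j).trans ((heq_of_eq (h1 _)).trans ?_))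
    exact h2 _ (Equiv.symm_apply_apply _ _)
  comp_one {a b} f := by
    refine hom_heq (Word.concat_single a) _ _ fun x x' hx => ?_
    refine congrArg f (funext fun i => eq_of_heq ((block_heq x i (0 : Fin 1)).trans (hx _ _ ?_)))
    exact Word.finSigma_one_val i
  one_comp {a b} f := by
    refine hom_heq (Word.concat_one a) _ _ fun x x' hx => ?_
    refine congrArg f (funext fun j => eq_of_heq ((block_heq x (0 : Fin 1) j).trans (hx _ _ ?_)))
    exact finSigmaFinEquiv_one _
  act_id f := rfl
  act_act τ hτ σ hσ ha ha' f := by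
    refine funext fun x => congrArg f (funext fun j => eq_of_heq ?_)
    exact (restrict_heq _ _ _ _).trans
      ((restrict_heq σ ha' _ j).trans (restrict_heq τ ha x (σ j))).symm
  comp_act {b c} g {a' a} σ hσ ha f := by
    refine funext fun x => ?_
    refine congrArg g (funext fun i => ?_)
    refine congrArg (f i) (funext fun j => ?_)
    refine eq_of_heq ((restrict_heq _ _ _ _).trans ((block_heq x _ _).trans ?_))
    refine HEq.trans ?_ ((block_heq _ _ _).trans (restrict_heq _ _ x _)).symm
    refine tuple_heq x ?_
    exact (finCoprod_mk σ i j).symm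
  act_comp {b c m} τ hτ g {a} f := by
    refine funext fun x => ?_
    refine congrArg g (funext fun i => ?_)
    refine eq_of_heq ((restrict_heq τ _ _ i).trans (heq_of_eq ?_))
    refine congrArg (f (τ i)) (funext fun j => ?_)
    refine eq_of_heq ((block_heq x _ _).trans ?_)
    refine HEq.trans ?_ ((block_heq _ _ _).trans (restrict_heq _ _ x _)).symm
    refine tuple_heq x ?_
    exact (finSimilarity_mk τ (fun i => (a i).len) i j).symm

/-! ### Context structures -/

/-- A context structure on a set `V` of letters: a relation between contexts (words without
repeated letters) and words over `V`. -/
structure ContextStructure (V : Type u) where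
  rel : Word V → Word V → Prop
  nodup : ∀ {c v}, rel c v → c.Nodup
  refl : ∀ {c : Word V}, c.Nodup → rel c c
  vars_subset : ∀ {c v}, rel c v → v.vars ⊆ c.vars
  concat : ∀ {c : Word V} {n : ℕ} {v w : Fin n → Word V},
    rel c (Word.concat v) → (∀ i, rel (v i) (w i)) → rel c (Word.concat w)
  subst : ∀ {c v d : Word V} (s : V → Word V), rel c v →
    rel d (Word.concat fun i => s (c.get i)) → rel d (Word.concat fun i => s (v.get i))

namespace ContextStructure

variable {V : Type u} (R : ContextStructure V)

/-- `R` is modelable if `c R v¹ ⋯ vⁿ` implies that there are contexts `c¹, …, cⁿ` with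
`c R c¹ ⋯ cⁿ` and `cⁱ R vⁱ`. -/
def Modelable : Prop :=
  ∀ {c : Word V} {n : ℕ} {v : Fin n → Word V}, R.rel c (Word.concat v) →
    ∃ d : Fin n → Word V, R.rel c (Word.concat d) ∧ ∀ i, R.rel (d i) (v i)

/-- `R` is balanced if `c R v` implies `Var(c) = Var(v)`. -/
def Balanced : Prop := ∀ {c v : Word V}, R.rel c v → c.vars = v.vars

/-- The context `c` is a terminal `R`-context of `v` if `w R c` is equivalent to `w R v` for all
contexts `w`. -/
def IsTerminal (c v : Word V) : Prop :=
  c.Nodup ∧ ∀ w : Word V, w.Nodup → (R.rel w c ↔ R.rel w v)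

/-- Every `R`-word has a terminal `R`-context. -/
def HasTerminalContexts : Prop := ∀ v : Word V, (∃ c, R.rel c v) → ∃ c, R.IsTerminal c v

/-- `R` is the cartesian context structure: `c R v` if and only if the letters of `v` are expressed
in the context `c`. -/
def IsCartesian : Prop := ∀ c v : Word V, R.rel c v ↔ c.Nodup ∧ v.vars ⊆ c.vars

/-- The function `θ : [m] → [n]` belongs to `Δ_R`: one has `c₁ ⋯ cₙ R c_{θ(1)} ⋯ c_{θ(m)}` for some
(equivalently, for every) context `c₁ ⋯ cₙ`, see `ContextStructure.memΔ_iff`. -/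
def MemΔ {m n : ℕ} (θ : Fin m → Fin n) : Prop :=
  ∃ c : Fin n → V, Function.Injective c ∧ R.rel ⟨n, c⟩ ⟨m, fun j => c (θ j)⟩

variable {R}

theorem exists_subst {n : ℕ} {c : Fin n → V} (hc : Function.Injective c) (d : Fin n → Word V) :
    ∃ s : V → Word V, ∀ i, s (c i) = d i :=
  ⟨Function.extend c d fun _ => ⟨0, Fin.elim0⟩, fun i => hc.extend_apply _ _ i⟩

/-- The substitution axiom for a context `c₁ ⋯ cₙ`, in terms of positions. -/
theorem rel_subst {m n : ℕ} {θ : Fin m → Fin n} {c : Fin n → V} (hc : Function.Injective c)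
    (h : R.rel ⟨n, c⟩ ⟨m, fun j => c (θ j)⟩) {e : Word V} (d : Fin n → Word V)
    (he : R.rel e (Word.concat d)) : R.rel e (Word.concat fun j => d (θ j)) := by
  obtain ⟨s, hs⟩ := exists_subst hc d
  have h1 := R.subst (d := e) s h
  have e1 : (Word.concat fun i => s (c i)) = Word.concat d :=
    congrArg Word.concat (funext hs)
  have e2 : (Word.concat fun j => s (c (θ j))) = Word.concat fun j => d (θ j) :=
    congrArg Word.concat (funext fun j => hs (θ j))
  exact e2 ▸ h1 (e1.symm ▸ he)

theorem MemΔ.rel {m n : ℕ} {θ : Fin m → Fin n} (h : R.MemΔ θ) {v : Word V} (d : Fin n → V)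
    (hd : R.rel v ⟨n, d⟩) : R.rel v ⟨m, fun j => d (θ j)⟩ := by
  obtain ⟨c, hc, hr⟩ := h
  have h1 := rel_subst (e := v) hc hr (fun i => Word.single (d i))
  rw [Word.concat_single ⟨n, d⟩, Word.concat_single ⟨m, fun j => d (θ j)⟩] at h1
  exact h1 hd

theorem exists_context [Infinite V] (n : ℕ) : ∃ c : Fin n → V, Function.Injective c :=
  ⟨fun i => Infinite.natEmbedding V i, fun _ _ h =>
    Fin.ext ((Infinite.natEmbedding V).injective h)⟩

theorem memΔ_iff [Infinite V] {m n : ℕ} {θ : Fin m → Fin n} :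
    R.MemΔ θ ↔ ∀ c : Fin n → V, Function.Injective c →
      R.rel ⟨n, c⟩ ⟨m, fun j => c (θ j)⟩ := by
  refine ⟨fun h c hc => h.rel c (R.refl (c := ⟨n, c⟩) hc), fun h => ?_⟩
  obtain ⟨c, hc⟩ := exists_context (V := V) n
  exact ⟨c, hc, h c hc⟩

variable (R)

/-- The structure category `Δ_R` of a context structure `R` on an infinite set. -/
def structureCategory [Infinite V] : StructureCategory where
  mem θ := R.MemΔ θ
  id_mem n := memΔ_iff.mpr fun c hc => R.refl (c := ⟨n, c⟩) hc
  comp_mem {k m n τ σ} hτ hσ :=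
    memΔ_iff.mpr fun c hc => hσ.rel (fun j => c (τ j)) (memΔ_iff.mp hτ c hc)
  coprod_mem {k m n f} h := by
    refine memΔ_iff.mpr fun c hc => ?_
    have e1 : Word.concat (fun i => (⟨n i, fun j => c (finSigmaFinEquiv ⟨i, j⟩)⟩ : Word V))
        = ⟨∑ i, n i, c⟩ :=
      Word.ext_get rfl fun p => congrArg c (Equiv.apply_symm_apply _ _)
    have h1 : R.rel ⟨∑ i, n i, c⟩
        (Word.concat fun i => (⟨n i, fun j => c (finSigmaFinEquiv ⟨i, j⟩)⟩ : Word V)) :=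
      e1.symm ▸ R.refl (c := ⟨∑ i, n i, c⟩) hc
    refine R.concat h1 (w := fun i => ⟨m i, fun j => c (finSigmaFinEquiv ⟨i, f i j⟩)⟩)
      fun i => ?_
    refine memΔ_iff.mp (h i) (fun j => c (finSigmaFinEquiv ⟨i, j⟩)) fun x y hxy => ?_
    simpa using hc hxy
  similarity_mem {m n θ} k h := by
    refine memΔ_iff.mpr fun c hc => ?_
    have e1 : Word.concat (fun i => (⟨k i, fun j => c (finSigmaFinEquiv ⟨i, j⟩)⟩ : Word V))
        = ⟨∑ i, k i, c⟩ :=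
      Word.ext_get rfl fun p => congrArg c (Equiv.apply_symm_apply _ _)
    have h1 : R.rel ⟨∑ i, k i, c⟩
        (Word.concat fun i => (⟨k i, fun j => c (finSigmaFinEquiv ⟨i, j⟩)⟩ : Word V)) :=
      e1.symm ▸ R.refl (c := ⟨∑ i, k i, c⟩) hc
    obtain ⟨z, hz, hr⟩ := h
    exact rel_subst hz hr _ h1

variable {R}

theorem exists_position {v w : Word V} (h : R.rel v w) :
    ∃ θ : Fin w.len → Fin v.len, ∀ j, w.get j = v.get (θ j) := by
  choose θ hθ using fun j : Fin w.len => R.vars_subset h (⟨j, rfl⟩ : w.Mem (w.get j))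
  exact ⟨θ, fun j => (hθ j).symm⟩

/-- If `v R w`, then `w = v_{θ(1)} ⋯ v_{θ(m)}` for this (unique) function `θ`. -/
noncomputable def position {v w : Word V} (h : R.rel v w) : Fin w.len → Fin v.len :=
  (exists_position h).choose

theorem get_position {v w : Word V} (h : R.rel v w) (j : Fin w.len) :
    w.get j = v.get (position h j) :=
  (exists_position h).choose_spec j

theorem position_mem [Infinite V] {v w : Word V} (h : R.rel v w) :
    R.structureCategory.mem (position h) := by
  refine ⟨v.get, R.nodup h, ?_⟩
  have e : (⟨w.len, fun j => v.get (position h j)⟩ : Word V) = w :=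
    Word.ext_get rfl fun j => (get_position h j).symm
  exact e.symm ▸ h

end ContextStructure

/-! ### Signatures, terms, equations -/

/-- A many-sorted algebraic signature together with countably infinitely many variables of each
sort. A function symbol `f` has type `dom f → cod f`; it is a constant symbol if `dom f` is the
empty word. -/
structure Signature where
  Srt : Type u
  Fn : Type u
  dom : Fn → Word Srt
  cod : Fn → Srt
  Var : Type u
  sort : Var → Srt
  infinite_vars : ∀ s, (sort ⁻¹' {s}).Infinite
  countable_vars : ∀ s, (sort ⁻¹' {s}).Countable

instance Signature.infinite_var (σ : Signature.{u}) [Nonempty σ.Srt] : Infinite σ.Var :=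
  let ⟨s⟩ := ‹Nonempty σ.Srt›
  Set.infinite_univ_iff.mp ((σ.infinite_vars s).mono (Set.subset_univ _))

/-- The terms of sort `s`. -/
inductive Term (σ : Signature.{u}) : σ.Srt → Type u
  | var (x : σ.Var) : Term σ (σ.sort x)
  | app (f : σ.Fn) (t : ∀ i, Term σ ((σ.dom f).get i)) : Term σ (σ.cod f)

/-- The word `τ(t)` of variables expressed in the term `t`, from left to right. -/
def Term.word {σ : Signature.{u}} : ∀ {s : σ.Srt}, Term σ s → Word σ.Var
  | _, .var x => Word.single x
  | _, .app _ t => Word.concat fun i => (t i).word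

/-- An `R`-equation `t₁ ≈_v t₂`: two terms of the same sort with a common `R`-context `v`. An
`R`-theory is a set of `R`-equations. -/
structure REquation (σ : Signature.{u}) (R : ContextStructure σ.Var) where
  sort : σ.Srt
  lhs : Term σ sort
  rhs : Term σ sort
  ctx : Word σ.Var
  lhs_ctx : R.rel ctx lhs.word
  rhs_ctx : R.rel ctx rhs.word

/-! ### Models and satisfaction -/

/-- A `σ`-model in a multicategory. -/
structure Model (σ : Signature.{u}) {Δ : StructureCategory} (C : Multicategory.{v, w} Δ) where
  obj : σ.Srt → C.Obj
  fn : ∀ f : σ.Fn, C.Hom ((σ.dom f).map obj) (obj (σ.cod f))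

section

variable {σ : Signature.{u}} [Nonempty σ.Srt] {R : ContextStructure σ.Var}
  {C : Multicategory.{v, w} R.structureCategory}

namespace Model

/-- The word `m_v = m(s₁) ⋯ m(sₙ)` for a word `v = x₁ ⋯ xₙ` of variables `xᵢ : sᵢ`. -/
def ctx (m : Model σ C) (v : Word σ.Var) : Word C.Obj := v.map fun x => m.obj (σ.sort x)

/-- The map `f ↦ f * m_{v,w}` from multimorphisms `m_w → b` to multimorphisms `m_v → b`, for
`v R w`. -/
noncomputable def canon (m : Model σ C) {v w : Word σ.Var} (h : R.rel v w) {b : C.Obj}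
    (f : C.Hom (m.ctx w) b) : C.Hom (m.ctx v) b :=
  C.act (a' := m.ctx w) (a := m.ctx v)
    (ContextStructure.position h : Fin w.len → Fin v.len)
    (ContextStructure.position_mem h)
    (fun j => congrArg (fun x => m.obj (σ.sort x)) (ContextStructure.get_position h j)) f

/-- The multimorphism `m_v(t) : m_v → m(s)` for a term `t : s` with an `R`-context `v`, where `R`
is modelable. In the case `t = f(t₁, …, t_k)` one chooses contexts `wᵢ` of `tᵢ` with
`v R w₁ ⋯ w_k`; the result does not depend on this choice. -/
noncomputable def eval (m : Model σ C) (hR : R.Modelable) :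
    ∀ {s : σ.Srt} (t : Term σ s) (v : Word σ.Var), R.rel v t.word → C.Hom (m.ctx v) (m.obj s)
  | _, .var x, _, h => m.canon (w := Word.single x) h (C.one (m.obj (σ.sort x)))
  | _, .app f t, _, h =>
    m.canon (w := Word.concat (hR h).choose) (hR h).choose_spec.1
      (C.comp (m.fn f) fun i => m.eval hR (t i) ((hR h).choose i) ((hR h).choose_spec.2 i))

/-- The model `m` satisfies the equation `t₁ ≈_v t₂`. -/
def Satisfies (m : Model σ C) (hR : R.Modelable) (e : REquation σ R) : Prop :=
  m.eval hR e.lhs e.ctx e.lhs_ctx = m.eval hR e.rhs e.ctx e.rhs_ctx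

end Model

/-- `E ⊨_C φ`: every `σ`-model in `C` that satisfies all equations of `E` satisfies `φ`. -/
def Entails (hR : R.Modelable) (C : Multicategory.{v, w} R.structureCategory)
    (E : Set (REquation σ R)) (φ : REquation σ R) : Prop :=
  ∀ m : Model σ C, (∀ e ∈ E, m.Satisfies hR e) → m.Satisfies hR φ

end

/-! ### Six classes of functions between finite ordinals -/

/-- A class of functions between finite ordinals. -/
abbrev FinFunClass := ∀ m n : ℕ, (Fin m → Fin n) → Prop

namespace FinFunClass

/-- The identities. -/
def identities : FinFunClass := fun m n θ => m = n ∧ ∀ i, (θ i : ℕ) = i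

/-- The bijections. -/
def bijections : FinFunClass := fun _ _ θ => Function.Bijective θ

/-- All functions. -/
def functions : FinFunClass := fun _ _ _ => True

/-- The surjections. -/
def surjections : FinFunClass := fun _ _ θ => Function.Surjective θ

/-- The left surjections: `min θ⁻¹{i} ≤ min θ⁻¹{j}` for `i ≤ j`. -/
def leftSurjections : FinFunClass := fun m n θ => Function.Surjective θ ∧
  ∀ (i j : Fin n) (x y : Fin m), i ≤ j → IsLeast (θ ⁻¹' {i}) x → IsLeast (θ ⁻¹' {j}) y → x ≤ y

/-- The right surjections: `max θ⁻¹{i} ≤ max θ⁻¹{j}` for `i ≤ j`. -/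
def rightSurjections : FinFunClass := fun m n θ => Function.Surjective θ ∧
  ∀ (i j : Fin n) (x y : Fin m), i ≤ j → IsGreatest (θ ⁻¹' {i}) x → IsGreatest (θ ⁻¹' {j}) y →
    x ≤ y

end FinFunClass

/-! ### Substitution and interpretation of terms in a multicategory -/

section

variable {σ : Signature.{u}}

/-! Part (a) is a completeness argument. Given a model `m` of `E` in `C`, one builds a model in sets
out of terms in which φ can hold only if it holds in `m`. Call two terms indistinguishable if they
have the same contexts in a set `K` and the same interpretations under `m` in those contexts. If
this is a congruence that identifies the instances of the equations of `E`, then the terms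
satisfying a predicate `P`, modulo this congruence, form a model of `E` in sets. So φ holds there,
and evaluating it at the classes of its own context variables shows that its two sides are
indistinguishable (`rel_of_entails`).

That the relation is a congruence follows from modelability, which lets one split a context among
the arguments of a function symbol. Closure under instances rests on `eval_subst`: the
interpretation of an instance is a composite with the interpretation of the original term, provided
the given context is also one of the substituted context of the equation. `entails_of_contexts`
isolates this proviso as a condition on `K` and `P`.

In the cartesian case `K` consists of the context of φ alone, and `P` selects the terms having that
context. In the balanced case `K` and `P` are unrestricted and the condition is `rel_of_rel_subst`:
if `v R w` and `d R s(w)`, then `d R s(v)`. When `w` has no repeated letter, `v R w` can be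
reversed, because the inverse of a permutation is one of its powers. A repeated letter together with
modelability forces `d R dd` for all contexts `d`; then every word has a context, and terminal
contexts make any two contexts of a word interchangeable.

For part (b), a substitution-invariant congruence on words that preserves the set of letters gives a
balanced structure with terminal contexts. Equality, permutation, equality of letter sets, and equal
order of last or of first occurrences yield five of the classes; the cartesian structure yields all
functions. -/

/-- Simultaneous substitution of terms for variables. -/
def Term.subst (s : ∀ x : σ.Var, Term σ (σ.sort x)) : ∀ {a : σ.Srt}, Term σ a → Term σ a
  | _, .var x => s x
  | _, .app f t => .app f fun i => (t i).subst s

theorem Term.subst_var : ∀ {a : σ.Srt} (t : Term σ a), t.subst Term.var = t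
  | _, .var _ => rfl
  | _, .app f t => congrArg (Term.app f) (funext fun i => (t i).subst_var)

theorem Term.word_subst (s : ∀ x : σ.Var, Term σ (σ.sort x)) : ∀ {a : σ.Srt} (t : Term σ a),
    (t.subst s).word = Word.concat fun j => (s (t.word.get j)).word
  | _, .var x => (Word.concat_one (s x).word).symm
  | _, .app f t => by
    refine (congrArg Word.concat (funext fun i => (t i).word_subst s)).trans ?_
    exact (Word.concat_concat (fun i => (t i).word)
      (fun i j => (s ((t i).word.get j)).word)).symm

namespace Multicategory

variable {Δ : StructureCategory} (C : Multicategory.{v, w} Δ)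

theorem act_congr {a' a : Word C.Obj} {b : C.Obj} {θ θ' : Fin a'.len → Fin a.len} (e : θ = θ')
    (h : Δ.mem θ) (h' : Δ.mem θ') (ha : ∀ j, a'.get j = a.get (θ j))
    (ha' : ∀ j, a'.get j = a.get (θ' j)) (f : C.Hom a' b) :
    C.act θ h ha f = C.act θ' h' ha' f := by
  subst e
  rfl

theorem comp_heq {b : Word C.Obj} {c : C.Obj} (g : C.Hom b c) {a a' : Fin b.len → Word C.Obj}
    (e : a = a') {f : ∀ i, C.Hom (a i) (b.get i)} {f' : ∀ i, C.Hom (a' i) (b.get i)}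
    (h : ∀ i, HEq (f i) (f' i)) : HEq (C.comp g f) (C.comp g f') := by
  subst e
  obtain rfl : f = f' := funext fun i => eq_of_heq (h i)
  rfl

end Multicategory

namespace Model

section

variable {Δ : StructureCategory} {C : Multicategory.{v, w} Δ}

/-- The interpretation of a term in the word of its variables. -/
def lin (m : Model σ C) : ∀ {s : σ.Srt} (t : Term σ s),
    C.Hom (t.word.map fun x => m.obj (σ.sort x)) (m.obj s)
  | _, .var x => C.one (m.obj (σ.sort x))
  | _, .app f t => C.comp (m.fn f) fun i => m.lin (t i)

/-- The left unit law settles variables and associativity settles function symbols. The equality is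
heterogeneous because the source words agree only through `Term.word_subst`. -/
theorem lin_subst (m : Model σ C) (s : ∀ x : σ.Var, Term σ (σ.sort x)) :
    ∀ {a : σ.Srt} (t : Term σ a), HEq (m.lin (t.subst s)) (C.comp (m.lin t) fun j => m.lin (s (t.word.get j)))
  | _, .var x => (C.one_comp (m.lin (s x))).symm
  | _, .app f t => by
    have ih := fun i => m.lin_subst s (t i)
    refine (C.comp_heq (m.fn f) (funext fun i =>
      congrArg (Word.map fun x => m.obj (σ.sort x)) ((t i).word_subst s)) ih).trans ?_
    exact (C.assoc (m.fn f) (fun i => m.lin (t i))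
      (fun i j => m.lin (s ((t i).word.get j)))).symm

end

variable [Nonempty σ.Srt] {R : ContextStructure σ.Var}
  {C : Multicategory.{v, w} R.structureCategory} (m : Model σ C)

/-- A context repeats no letter, so the positions in it of the letters of `w` are unique. Composite
index functions therefore never have to be computed: any one that reproduces `w` is the canonical
one. -/
theorem act_eq_canon {v w : Word σ.Var} (h : R.rel v w) {b : C.Obj} (f : C.Hom (m.ctx w) b)
    (θ : Fin w.len → Fin v.len) (hθ : R.structureCategory.mem θ)
    (e : ∀ j, w.get j = v.get (θ j))
    (ha : ∀ j, (m.ctx w).get j = (m.ctx v).get (θ j)) :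
    C.act (a' := m.ctx w) (a := m.ctx v) θ hθ ha f = m.canon h f :=
  C.act_congr (funext fun j => R.nodup h ((e j).symm.trans (ContextStructure.get_position h j)))
    _ _ _ _ _

theorem canon_heq {v w w' : Word σ.Var} (h : R.rel v w) (h' : R.rel v w') (e : w = w') {b : C.Obj}
    {f : C.Hom (m.ctx w) b} {f' : C.Hom (m.ctx w') b} (hf : HEq f f') :
    m.canon h f = m.canon h' f' := by
  subst e
  rw [eq_of_heq hf]

/-- The law `comp_act` moves the inner actions outside, where they merge with the outer one. -/
theorem canon_comp_canon {u : Word σ.Var} {b : Word C.Obj} {c : C.Obj} (g : C.Hom b c)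
    {v w : Fin b.len → Word σ.Var} (hu : R.rel u (Word.concat v)) (h : ∀ i, R.rel (v i) (w i))
    (f : ∀ i, C.Hom (m.ctx (w i)) (b.get i)) :
    m.canon hu (C.comp g (a := fun i => m.ctx (v i)) fun i => m.canon (h i) (f i))
      = m.canon (R.concat hu h) (C.comp g (a := fun i => m.ctx (w i)) f) := by
  have h1 := C.comp_act g (a' := fun i => m.ctx (w i)) (a := fun i => m.ctx (v i))
    (fun i => (ContextStructure.position (h i) : Fin (w i).len → Fin (v i).len))
    (fun i => ContextStructure.position_mem (h i))
    (fun i j => congrArg (fun x => m.obj (σ.sort x)) (ContextStructure.get_position (h i) j)) f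
  refine (congrArg (m.canon hu) h1).trans ?_
  have hm := R.structureCategory.coprod_mem fun i => ContextStructure.position_mem (h i)
  have hg := Word.concat_get_coprod (fun i => ContextStructure.position (h i))
    (fun i => ContextStructure.get_position (h i))
  refine (C.act_act (a'' := m.ctx (Word.concat w)) (a' := m.ctx (Word.concat v)) (a := m.ctx u)
    (ContextStructure.position hu : Fin _ → Fin u.len) (ContextStructure.position_mem hu)
    _ hm _ _ _).symm.trans ?_
  refine m.act_eq_canon _ _ _ _ (fun j => ?_) _
  exact (hg j).trans (ContextStructure.get_position hu _)

/-- The counterpart for an action on the outer multimorphism, by the law `act_comp`. The inner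
multimorphisms have to depend only on the letters, so that they can be reindexed from `v` to `w`. -/
theorem canon_comp_canon_left {u v w : Word σ.Var} (h : R.rel v w) {c : C.Obj}
    (g : C.Hom (m.ctx w) c) (W : σ.Var → Word σ.Var)
    (F : ∀ x, C.Hom (m.ctx (W x)) (m.obj (σ.sort x)))
    (hu : R.rel u (Word.concat fun i => W (v.get i)))
    (hu' : R.rel u (Word.concat fun j => W (w.get j))) :
    m.canon hu (C.comp (m.canon h g) (a := fun i => m.ctx (W (v.get i))) fun i => F (v.get i))
      = m.canon hu' (C.comp g (a := fun j => m.ctx (W (w.get j))) fun j => F (w.get j)) := by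
  -- `act_comp` needs a source that is literally a pullback, so `w` is replaced by the word of
  -- letters of `v` along its position function.
  obtain ⟨n, w⟩ := w
  obtain ⟨θ, hθ, hm⟩ : ∃ θ : Fin n → Fin v.len, (∀ j, w j = v.get (θ j)) ∧
      R.structureCategory.mem θ :=
    ⟨_, ContextStructure.get_position h, ContextStructure.position_mem h⟩
  obtain rfl : w = fun j => v.get (θ j) := funext hθ
  rw [← m.act_eq_canon h g θ hm hθ (fun _ => rfl)]
  have h1 := C.act_comp (b := m.ctx v) θ hm g (a := fun i => m.ctx (W (v.get i)))
    (fun i => F (v.get i))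
  refine (congrArg (m.canon hu) h1).trans ?_
  have hg := Word.concat_get_similarity (fun i => W (v.get i)) θ
  refine (C.act_act (a'' := m.ctx (Word.concat fun j => W (v.get (θ j))))
    (a' := m.ctx (Word.concat fun i => W (v.get i))) (a := m.ctx u)
    (ContextStructure.position hu : Fin _ → Fin u.len) (ContextStructure.position_mem hu) _
    (R.structureCategory.similarity_mem _ hm) _ _ _).symm.trans ?_
  refine m.act_eq_canon _ _ _ _ (fun j => ?_) _
  exact (hg j).trans (ContextStructure.get_position hu _)

/-- The interpretation of a term in a context arises from the one in its own word. -/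
theorem eval_eq_canon_lin (m : Model σ C) (hR : R.Modelable) :
    ∀ {s : σ.Srt} (t : Term σ s) (v : Word σ.Var) (h : R.rel v t.word), m.eval hR t v h = m.canon h (m.lin t)
  | _, .var x, _, h => rfl
  | _, .app f t, v, h => by
    have ih := fun i => m.eval_eq_canon_lin hR (t i) _ ((hR h).choose_spec.2 i)
    refine (congrArg (fun g => m.canon (w := Word.concat (hR h).choose) (hR h).choose_spec.1
      (C.comp (m.fn f) (a := fun i => m.ctx ((hR h).choose i)) g)) (funext ih)).trans ?_
    exact m.canon_comp_canon (m.fn f) (hR h).choose_spec.1 (hR h).choose_spec.2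
      fun i => m.lin (t i)

/-- Independence of the chosen contexts of the arguments: for every choice, both sides reduce to the
interpretation `lin`, which involves no choice. -/
theorem eval_app (hR : R.Modelable) (f : σ.Fn) (t : ∀ i, Term σ ((σ.dom f).get i))
    {v : Word σ.Var} (h : R.rel v (Term.app f t).word) (d : Fin (σ.dom f).len → Word σ.Var)
    (hd : R.rel v (Word.concat d)) (hdt : ∀ i, R.rel (d i) (t i).word) :
    m.eval hR (.app f t) v h
      = m.canon hd (C.comp (m.fn f) (a := fun i => m.ctx (d i))
          fun i => m.eval hR (t i) (d i) (hdt i)) := by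
  refine (m.eval_eq_canon_lin hR _ v h).trans
    ((m.canon_comp_canon (m.fn f) hd hdt fun i => m.lin (t i)).symm.trans ?_)
  exact congrArg (fun g => m.canon hd (C.comp (m.fn f) (a := fun i => m.ctx (d i)) g))
    (funext fun i => (m.eval_eq_canon_lin hR (t i) _ (hdt i)).symm)

/-- The right-hand side sees `t` only through its interpretation in `v`; this carries a satisfied
equation over to its instances. -/
theorem eval_subst (hR : R.Modelable) {a : σ.Srt} (t : Term σ a) {v u : Word σ.Var}
    (h : R.rel v t.word) (s : ∀ x : σ.Var, Term σ (σ.sort x))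
    (hu : R.rel u (Word.concat fun i => (s (v.get i)).word))
    (hu' : R.rel u (t.subst s).word) :
    m.eval hR (t.subst s) u hu'
      = m.canon hu (C.comp (m.eval hR t v h) (a := fun i => m.ctx (s (v.get i)).word)
          fun i => m.lin (s (v.get i))) := by
  have hu'' := (t.word_subst s) ▸ hu'
  rw [eval_eq_canon_lin, eval_eq_canon_lin,
    m.canon_comp_canon_left h (m.lin t) (fun x => (s x).word) (fun x => m.lin (s x)) hu hu'']
  exact m.canon_heq _ _ (t.word_subst s) (m.lin_subst s t)

end Model

end

/-! ### Term models in sets -/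

namespace Model

variable {σ : Signature.{u}}

section

variable {Δ : StructureCategory}

theorem cast_rel (M : Model σ (setMulticategory.{u} Δ))
    (Q : ∀ a : σ.Srt, (show Type u from M.obj a) → Term σ a → Prop)
    (s : ∀ x : σ.Var, Term σ (σ.sort x)) {x y : σ.Var} (e : x = y)
    (he : (show Type u from M.obj (σ.sort x)) = (show Type u from M.obj (σ.sort y)))
    (z : show Type u from M.obj (σ.sort x)) (h : Q _ z (s x)) : Q _ (cast he z) (s y) := by
  subst e
  exact h

/-- A relation between a model in sets and terms that is compatible with the function symbols is
compatible with the interpretation of terms. -/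
theorem lin_rel (M : Model σ (setMulticategory.{u} Δ))
    (Q : ∀ a : σ.Srt, (show Type u from M.obj a) → Term σ a → Prop)
    (hQ : ∀ (f : σ.Fn) (x : ∀ i, show Type u from M.obj ((σ.dom f).get i))
      (t : ∀ i, Term σ ((σ.dom f).get i)), (∀ i, Q _ (x i) (t i)) → Q _ (M.fn f x) (.app f t))
    (s : ∀ x : σ.Var, Term σ (σ.sort x)) : ∀ {a : σ.Srt} (t : Term σ a)
    (x : ∀ j, show Type u from M.obj (σ.sort (t.word.get j))),
    (∀ j, Q _ (x j) (s (t.word.get j))) → Q a (M.lin t x) (t.subst s)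
  | _, .var _, _, hx => hx (0 : Fin 1)
  | _, .app f t, x, hx => by
    refine hQ f _ _ fun i => M.lin_rel Q hQ s (t i) _ fun j => ?_
    exact M.cast_rel Q s (Word.concat_get_mk (fun i => (t i).word) i j) _ _ (hx _)

end

/-- Used with `Q` the graph of the class map on terms; it then says that a term evaluates to the
class of its instance. -/
theorem eval_rel [Nonempty σ.Srt] {R : ContextStructure σ.Var} (hR : R.Modelable)
    (M : Model σ (setMulticategory.{u} R.structureCategory))
    (Q : ∀ a : σ.Srt, (show Type u from M.obj a) → Term σ a → Prop)
    (hQ : ∀ (f : σ.Fn) (x : ∀ i, show Type u from M.obj ((σ.dom f).get i))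
      (t : ∀ i, Term σ ((σ.dom f).get i)), (∀ i, Q _ (x i) (t i)) → Q _ (M.fn f x) (.app f t))
    (s : ∀ x : σ.Var, Term σ (σ.sort x)) {a : σ.Srt} (t : Term σ a) (v : Word σ.Var)
    (h : R.rel v t.word) (x : ∀ j, show Type u from M.obj (σ.sort (v.get j)))
    (hx : ∀ j, Q _ (x j) (s (v.get j))) : Q a (M.eval hR t v h x) (t.subst s) := by
  rw [eval_eq_canon_lin]
  refine M.lin_rel Q hQ s t _ fun j => ?_
  exact M.cast_rel Q s (ContextStructure.get_position h j).symm _ _ (hx _)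

end Model

section

variable {σ : Signature.{u}}

/-- A substitution with prescribed values at the letters of a context. -/
theorem exists_substitution {v : Word σ.Var} (hv : v.Nodup)
    (t : ∀ i, Term σ (σ.sort (v.get i))) :
    ∃ s : ∀ x : σ.Var, Term σ (σ.sort x), ∀ i, s (v.get i) = t i := by
  classical
  -- Outside the context the value is immaterial; variables are left fixed there.
  refine ⟨fun x => if h : ∃ i, v.get i = x then h.choose_spec ▸ t h.choose else .var x,
    fun i => ?_⟩
  have h : ∃ j, v.get j = v.get i := ⟨i, rfl⟩
  refine (dif_pos h).trans ?_
  have key : ∀ (j : Fin v.len) (e : v.get j = v.get i), e ▸ t j = t i := by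
    intro j e
    obtain rfl := hv e
    rfl
  exact key _ h.choose_spec

variable (P : ∀ a, Term σ a → Prop) (r : ∀ a, Setoid (Term σ a))

/-- The setoid on the terms satisfying `P`. -/
abbrev termSetoid (a : σ.Srt) : Setoid {t : Term σ a // P a t} := (r a).comap Subtype.val

/-- The model of terms satisfying `P` up to a congruence. -/
noncomputable def termModel {Δ : StructureCategory}
    (hP : ∀ f t, (∀ i, P _ (t i)) → P _ (Term.app f t)) :
    Model σ (setMulticategory.{u} Δ) where
  obj a := Quotient (termSetoid P r a)
  -- Chosen representatives make the operation definable without assuming that `r` is a congruence;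
  -- that assumption enters only when `Q` is shown to respect the function symbols.
  fn f := fun x => Quotient.mk (termSetoid P r _) ⟨.app f fun i => (x i).out.1,
    hP f _ fun i => (x i).out.2⟩

/-- A consequence of `E` in sets holds in every congruence on terms that is closed under the
instances of `E`. -/
theorem rel_of_entails [Nonempty σ.Srt] {R : ContextStructure σ.Var} (hR : R.Modelable)
    {E : Set (REquation σ R)} {φ : REquation σ R}
    (h : Entails hR (setMulticategory.{u} R.structureCategory) E φ)
    (hP : ∀ f t, (∀ i, P _ (t i)) → P _ (Term.app f t))
    (hr : ∀ f t t', (∀ i, (r _).r (t i) (t' i)) → (r _).r (Term.app f t) (Term.app f t'))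
    (hE : ∀ e ∈ E, ∀ s : ∀ x : σ.Var, Term σ (σ.sort x), (∀ i, P _ (s (e.ctx.get i))) →
      (r _).r (e.lhs.subst s) (e.rhs.subst s))
    (hφ : ∀ i, P _ (Term.var (φ.ctx.get i))) : (r _).r φ.lhs φ.rhs := by
  let M : Model σ (setMulticategory.{u} R.structureCategory) := termModel P r hP
  let Q : ∀ a : σ.Srt, Quotient (termSetoid P r a) → Term σ a → Prop :=
    fun a x t => ∃ ht : P a t, x = Quotient.mk (termSetoid P r a) ⟨t, ht⟩
  have hQ : ∀ (f : σ.Fn) (x : ∀ i, Quotient (termSetoid P r ((σ.dom f).get i)))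
      (t : ∀ i, Term σ ((σ.dom f).get i)), (∀ i, Q _ (x i) (t i)) →
        Q _ (M.fn f x) (.app f t) := by
    intro f x t hx
    refine ⟨hP f t fun i => (hx i).1, Quotient.sound (hr f _ _ fun i => ?_)⟩
    exact Quotient.exact (s := termSetoid P r _) ((Quotient.out_eq (x i)).trans (hx i).2)
  have hM : ∀ e ∈ E, M.Satisfies hR e := by
    intro e he
    refine funext fun (x : ∀ i, Quotient (termSetoid P r (σ.sort (e.ctx.get i)))) => ?_
    obtain ⟨s, hs⟩ := exists_substitution (R.nodup e.lhs_ctx) fun i => (x i).out.1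
    have hx : ∀ i, Q _ (x i) (s (e.ctx.get i)) := by
      intro i
      rw [hs i]
      exact ⟨(x i).out.2, (Quotient.out_eq (x i)).symm⟩
    obtain ⟨h1, e1⟩ := M.eval_rel hR Q hQ s e.lhs e.ctx e.lhs_ctx x hx
    obtain ⟨h2, e2⟩ := M.eval_rel hR Q hQ s e.rhs e.ctx e.rhs_ctx x hx
    refine e1.trans (Eq.trans ?_ e2.symm)
    exact Quotient.sound (hE e he s fun i => (hx i).1)
  -- Evaluation at the classes of the context variables corresponds to the identity substitution, so
  -- the two values are the classes of the sides of φ themselves.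
  have h0 := congrFun (h M hM)
    (fun i => Quotient.mk (termSetoid P r (σ.sort (φ.ctx.get i))) ⟨.var (φ.ctx.get i), hφ i⟩)
  obtain ⟨h1, e1⟩ := M.eval_rel hR Q hQ Term.var φ.lhs φ.ctx φ.lhs_ctx _
    fun i => ⟨hφ i, rfl⟩
  obtain ⟨h2, e2⟩ := M.eval_rel hR Q hQ Term.var φ.rhs φ.ctx φ.rhs_ctx _
    fun i => ⟨hφ i, rfl⟩
  have h3 : (r _).r (φ.lhs.subst Term.var) (φ.rhs.subst Term.var) :=
    Quotient.exact (s := termSetoid P r _) (e1.symm.trans (h0.trans e2))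
  rwa [Term.subst_var, Term.subst_var] at h3

/-! ### From sets to an arbitrary multicategory -/

variable [Nonempty σ.Srt] {R : ContextStructure σ.Var}
  {C : Multicategory.{v, w} R.structureCategory}

/-- Two terms are identified if they have the same contexts in `K` and the same interpretations
in these contexts. -/
def Model.indistinguishable (m : Model σ C) (hR : R.Modelable) (K : Set (Word σ.Var))
    (a : σ.Srt) : Setoid (Term σ a) where
  r t t' := ∀ c ∈ K, (R.rel c t.word ↔ R.rel c t'.word) ∧
    ∀ h h', m.eval hR t c h = m.eval hR t' c h'
  iseqv :=
    { refl _ _ _ := ⟨Iff.rfl, fun _ _ => rfl⟩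
      symm h c hc := ⟨(h c hc).1.symm, fun h1 h2 => ((h c hc).2 h2 h1).symm⟩
      trans h h' c hc := ⟨(h c hc).1.trans (h' c hc).1, fun h1 h2 =>
        ((h c hc).2 h1 ((h c hc).1.mp h1)).trans ((h' c hc).2 _ h2)⟩ }

/-- Indistinguishability is fed into `rel_of_entails`. `hK` keeps the splitting of contexts inside
`K`, which gives the congruence property; `hPK` is the proviso of `eval_subst`, needed only for
substitutions with values in `P`. -/
theorem entails_of_contexts (hR : R.Modelable) {E : Set (REquation σ R)} {φ : REquation σ R}
    (h : Entails hR (setMulticategory.{u} R.structureCategory) E φ) (K : Set (Word σ.Var))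
    (hK : ∀ c ∈ K, ∀ (n : ℕ) (v : Fin n → Word σ.Var), R.rel c (Word.concat v) →
      ∃ d : Fin n → Word σ.Var, (∀ i, d i ∈ K) ∧ R.rel c (Word.concat d) ∧
        ∀ i, R.rel (d i) (v i))
    (hP : ∀ f t, (∀ i, P _ (t i)) → P _ (Term.app f t))
    (hPK : ∀ (s : ∀ x : σ.Var, Term σ (σ.sort x)) (v w : Word σ.Var),
      (∀ i, P _ (s (v.get i))) → R.rel v w → ∀ c ∈ K,
        R.rel c (Word.concat fun j => (s (w.get j)).word) →
        R.rel c (Word.concat fun i => (s (v.get i)).word))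
    (hφK : φ.ctx ∈ K) (hφ : ∀ i, P _ (Term.var (φ.ctx.get i))) : Entails hR C E φ := by
  intro m hm
  have key : ∀ (f : σ.Fn) (t t' : ∀ i, Term σ ((σ.dom f).get i)),
      (∀ i, (m.indistinguishable hR K _).r (t i) (t' i)) → ∀ c ∈ K,
      R.rel c (Term.app f t).word → ∃ h' : R.rel c (Term.app f t').word,
        ∀ h, m.eval hR (.app f t) c h = m.eval hR (.app f t') c h' := by
    intro f t t' ht c hc hct
    -- Since indistinguishable arguments have the same contexts in `K`, one splitting `d` serves
    -- both terms.
    obtain ⟨d, hdK, hd, hdt⟩ := hK c hc _ _ hct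
    have hdt' := fun i => (ht i (d i) (hdK i)).1.mp (hdt i)
    refine ⟨R.concat hd hdt', fun h => ?_⟩
    refine (m.eval_app hR f t h d hd hdt).trans
      (Eq.trans ?_ (m.eval_app hR f t' _ d hd hdt').symm)
    exact congrArg (fun g => m.canon hd (C.comp (m.fn f) (a := fun i => m.ctx (d i)) g))
      (funext fun i => (ht i (d i) (hdK i)).2 _ _)
  refine (rel_of_entails P (m.indistinguishable hR K) hR h hP ?_ ?_ hφ φ.ctx hφK).2 _ _
  · intro f t t' ht c hc
    refine ⟨⟨fun h1 => (key f t t' ht c hc h1).1, fun h1 =>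
      (key f t' t (fun i => (m.indistinguishable hR K _).symm (ht i)) c hc h1).1⟩, fun h1 h2 => ?_⟩
    exact (key f t t' ht c hc h1).2 _
  · intro e he s hs c hc
    -- Contexts pass from an instance of one side to the instance of the common context by `hPK`,
    -- and from there to the other side by the substitution axiom.
    have hcv : ∀ t : Term σ e.sort, R.rel e.ctx t.word → R.rel c (t.subst s).word →
        R.rel c (Word.concat fun i => (s (e.ctx.get i)).word) := fun t ht h1 =>
      hPK s _ _ hs ht c hc (t.word_subst s ▸ h1)
    have hcv' : ∀ t : Term σ e.sort, R.rel e.ctx t.word →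
        R.rel c (Word.concat fun i => (s (e.ctx.get i)).word) → R.rel c (t.subst s).word :=
      fun t ht h1 => (t.word_subst s).symm ▸
        R.subst (fun x => (s x).word) ht h1
    refine ⟨⟨fun h1 => hcv' _ e.rhs_ctx (hcv _ e.lhs_ctx h1),
      fun h1 => hcv' _ e.lhs_ctx (hcv _ e.rhs_ctx h1)⟩, fun h1 h2 => ?_⟩
    have hv := hcv _ e.lhs_ctx h1
    refine (m.eval_subst hR e.lhs e.lhs_ctx s hv h1).trans
      (Eq.trans ?_ (m.eval_subst hR e.rhs e.rhs_ctx s hv h2).symm)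
    exact congrArg (fun g : C.Hom (m.ctx e.ctx) _ => m.canon hv (C.comp g
      (a := fun i => m.ctx (s (e.ctx.get i)).word) fun i => m.lin (s (e.ctx.get i)))) (hm e he)

end

/-! ### Words as lists -/

namespace Word

variable {A : Type u}

/-- The list of letters of a word. -/
def toList (w : Word A) : List A := List.ofFn w.get

/-- The word with a given list of letters. -/
def ofList (l : List A) : Word A := ⟨l.length, l.get⟩

@[simp] theorem toList_ofList (l : List A) : (ofList l).toList = l := List.ofFn_get l

theorem toList_injective : Function.Injective (toList : Word A → List A) := by
  intro a b h
  have h1 : a.len = b.len := by simpa [toList] using congrArg List.length h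
  obtain ⟨n, a⟩ := a
  obtain ⟨m, b⟩ := b
  obtain rfl : n = m := h1
  exact congrArg (Word.mk n) (List.ofFn_injective h)

@[simp] theorem ofList_toList (w : Word A) : ofList w.toList = w :=
  toList_injective (toList_ofList _)

theorem mem_toList {w : Word A} {x : A} : x ∈ w.toList ↔ x ∈ w.vars := by
  simp [toList, List.mem_ofFn, vars, Mem]

theorem nodup_toList {w : Word A} : w.toList.Nodup ↔ w.Nodup := List.nodup_ofFn

theorem concat_succ {n : ℕ} (w : Fin (n + 1) → Word A) :
    concat w = ⟨(w 0).len + (concat fun i => w i.succ).len,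
      Fin.append (w 0).get (concat fun i => w i.succ).get⟩ := by
  refine ext_get (Fin.sum_univ_succ _) fun p => ?_
  obtain ⟨⟨i, x⟩, rfl⟩ := finSigmaFinEquiv.surjective p
  rw [concat_get_mk]
  induction i using Fin.cases with
  | zero =>
    refine (Fin.append_left (w 0).get (concat fun i => w i.succ).get x).symm.trans
      (congrArg (Fin.append (w 0).get (concat fun i => w i.succ).get) (Fin.ext ?_))
    change (x : ℕ) = (finSigmaFinEquiv (⟨0, x⟩ : (i : Fin (n + 1)) × Fin (w i).len) : ℕ)
    rw [finSigmaFinEquiv_apply]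
    simp
  | succ i =>
    refine ((concat_get_mk (fun i => w i.succ) i x).symm.trans
      (Fin.append_right (w 0).get (concat fun i => w i.succ).get _).symm).trans
      (congrArg (Fin.append (w 0).get (concat fun i => w i.succ).get) (Fin.ext ?_))
    change (w 0).len + (finSigmaFinEquiv (⟨i, x⟩ : (i : Fin n) × Fin (w i.succ).len) : ℕ)
      = (finSigmaFinEquiv (⟨i.succ, x⟩ : (i : Fin (n + 1)) × Fin (w i).len) : ℕ)
    rw [finSigmaFinEquiv_apply, finSigmaFinEquiv_apply]
    simp only [Fin.val_succ, Fin.sum_univ_succ, ← add_assoc]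
    rfl

theorem toList_concat {n : ℕ} (w : Fin n → Word A) :
    (concat w).toList = (List.ofFn fun i => (w i).toList).flatten := by
  induction n with
  | zero =>
    rw [List.ofFn_zero, List.flatten_nil, ← List.length_eq_zero_iff]
    simp [toList, concat]
  | succ n ih =>
    rw [List.ofFn_succ, List.flatten_cons, ← ih, concat_succ]
    exact List.ofFn_fin_append _ _

theorem toList_concat_get (w : Word A) {B : Type v} (s : A → Word B) :
    (concat fun i => s (w.get i)).toList = w.toList.flatMap fun x => (s x).toList := by
  rw [toList_concat, List.flatMap_def, toList, List.map_ofFn]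
  rfl

theorem mem_vars_concat {n : ℕ} {w : Fin n → Word A} {x : A} :
    x ∈ (concat w).vars ↔ ∃ i, x ∈ (w i).vars := by
  simp [← mem_toList, toList_concat]

end Word

/-! ### Combinatorics of balanced context structures -/

namespace ContextStructure

open Word

variable {V : Type u} {R : ContextStructure V}

theorem trans {u v w : Word V} (h : R.rel u v) (h' : R.rel v w) : R.rel u w := by
  have := R.concat (c := u) (v := fun _ : Fin 1 => v) (w := fun _ : Fin 1 => w)
    ((concat_one v).symm ▸ h) fun _ => h'
  rwa [concat_one] at this

theorem rel_append {c a b a' b' : List V} (h : R.rel (ofList c) (ofList (a ++ b)))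
    (ha : R.rel (ofList a) (ofList a')) (hb : R.rel (ofList b) (ofList b')) :
    R.rel (ofList c) (ofList (a' ++ b')) := by
  have e : ∀ a b : List V, Word.concat ![ofList a, ofList b] = ofList (a ++ b) := fun a b =>
    toList_injective (by simp [toList_concat])
  rw [← e] at h ⊢
  refine R.concat h fun i => ?_
  fin_cases i
  · exact ha
  · exact hb

theorem Modelable.append (hR : R.Modelable) {c a b : List V}
    (h : R.rel (ofList c) (ofList (a ++ b))) :
    ∃ a' b' : List V, R.rel (ofList a') (ofList a) ∧ R.rel (ofList b') (ofList b) := by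
  have e : ∀ a b : List V, Word.concat ![ofList a, ofList b] = ofList (a ++ b) := fun a b =>
    toList_injective (by simp [toList_concat])
  rw [← e] at h
  obtain ⟨d, -, hd⟩ := hR h
  exact ⟨(d 0).toList, (d 1).toList, by simpa using hd 0, by simpa using hd 1⟩

theorem rel_flatMap {c v d : List V} (s : V → List V) (h : R.rel (ofList c) (ofList v))
    (hd : R.rel (ofList d) (ofList (c.flatMap s))) : R.rel (ofList d) (ofList (v.flatMap s)) := by
  have e : ∀ l : List V, (Word.concat fun i => ofList (s ((ofList l).get i)))
      = ofList (l.flatMap s) := fun l => toList_injective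
    ((toList_concat_get (ofList l) fun x => ofList (s x)).trans (by simp))
  rw [← e] at hd ⊢
  exact R.subst (fun x => ofList (s x)) h hd

theorem rel_refl_list {c : List V} (h : c.Nodup) : R.rel (ofList c) (ofList c) :=
  R.refl (nodup_toList.mp (by simpa using h))

theorem Balanced.mem_iff (hb : R.Balanced) {c v : List V} (h : R.rel (ofList c) (ofList v))
    (x : V) : x ∈ c ↔ x ∈ v := by
  have := congrArg (x ∈ ·) (hb h)
  simpa [← mem_toList] using this

theorem nodup_list {c v : List V} (h : R.rel (ofList c) (ofList v)) : c.Nodup := by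
  simpa using nodup_toList.mpr (R.nodup h)

/-- The permutations in `Δ_R` form a group, so contexts that are related to each other by a
balanced structure are related in both directions. -/
theorem Balanced.symm [Infinite V] (hb : R.Balanced) {c d : Word V} (hd : d.Nodup)
    (h : R.rel c d) : R.rel d c := by
  have hlen : c.len = d.len := by
    have h1 : Set.range c.get = Set.range d.get := hb h
    have h2 := congrArg Set.ncard h1
    simpa [← Set.image_univ, Set.ncard_image_of_injective _ (R.nodup h),
      Set.ncard_image_of_injective _ hd] using h2
  obtain ⟨n, c⟩ := c
  obtain ⟨m, d⟩ := d
  obtain rfl : n = m := hlen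
  obtain ⟨θ, hθ⟩ : ∃ θ : Fin n → Fin n, ∀ j, d j = c (θ j) := exists_position h
  obtain rfl : d = fun j => c (θ j) := funext hθ
  have hinj : Function.Injective θ := fun i j hij => hd (congrArg c hij)
  let π : Equiv.Perm (Fin n) := Equiv.ofBijective θ (Finite.injective_iff_bijective.mp hinj)
  have hmem : ∀ k : ℕ, R.structureCategory.mem (⇑(π ^ k)) := by
    intro k
    induction k with
    | zero => exact R.structureCategory.id_mem n
    | succ k ih =>
      rw [pow_succ, Equiv.Perm.coe_mul]
      exact R.structureCategory.comp_mem ih ⟨c, R.nodup h, h⟩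
  -- The inverse of `π` is a nonnegative power of `π`, hence lies in the structure category.
  obtain ⟨k, hk⟩ : ∃ k : ℕ, π * π ^ k = 1 := by
    refine ⟨orderOf π - 1, ?_⟩
    rw [← pow_succ', Nat.sub_add_cancel (orderOf_pos π), pow_orderOf_eq_one]
  have h1 := memΔ_iff.mp (hmem k) _ hd
  have h2 : (fun j => c (θ ((π ^ k) j))) = c :=
    funext fun j => congrArg c (congrFun (congrArg DFunLike.coe hk) j)
  rwa [h2] at h1

/-- Both contexts are related to a terminal context of `v`, and the relation from `d` can be
reversed by balance. -/
theorem rel_contexts [Infinite V] (hb : R.Balanced) (ht : R.HasTerminalContexts)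
    {c d v : Word V} (hc : R.rel c v) (hd : R.rel d v) : R.rel c d := by
  obtain ⟨e, he, h⟩ := ht v ⟨c, hc⟩
  exact trans ((h c (R.nodup hc)).mpr hc) (hb.symm he ((h d (R.nodup hd)).mpr hd))

/-- Induction on the word, adding a letter `y` at the end. If `y` already occurs in the context `a y
b` found so far, then `y b y` is a factor of the square of `y b`, so modelability gives it a context
`e`. By balance `e` has the letters of `y b`, hence `a e` is again a context. -/
theorem exists_rel_of_square (hR : R.Modelable) (hb : R.Balanced)
    (hsq : ∀ c : List V, c.Nodup → R.rel (ofList c) (ofList (c ++ c))) (v : List V) :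
    ∃ c, R.rel (ofList c) (ofList v) := by
  induction v using List.reverseRecOn with
  | nil => exact ⟨[], rel_refl_list List.nodup_nil⟩
  | append_singleton v y ih =>
    obtain ⟨c, hc⟩ := ih
    have hcn := nodup_list hc
    have hy : R.rel (ofList [y]) (ofList [y]) := rel_refl_list (List.nodup_singleton y)
    by_cases hyc : y ∈ c
    · obtain ⟨a, b, rfl⟩ := List.append_of_mem hyc
      obtain ⟨ha, hyb, hab⟩ := List.nodup_append'.mp hcn
      have h1 := hsq _ hyb
      have h2 : y :: b ++ y :: b = (y :: b ++ [y]) ++ b := by simp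
      rw [h2] at h1
      obtain ⟨e, -, he, -⟩ := hR.append h1
      have hmem := hb.mem_iff he
      have hae : (a ++ e).Nodup := by
        refine List.nodup_append'.mpr ⟨ha, nodup_list he, fun x hxa hxe => hab hxa ?_⟩
        have := (hmem x).mp hxe
        simp only [List.mem_append, List.mem_cons, List.not_mem_nil, or_false] at this ⊢
        tauto
      have h3 := rel_append (rel_refl_list hae) (rel_refl_list ha) he
      refine ⟨a ++ e, rel_append (a := a ++ y :: b) (b := [y]) ?_ hc hy⟩
      simpa using h3
    · refine ⟨c ++ [y], rel_append (rel_refl_list ?_) hc hy⟩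
      simpa [List.nodup_append'] using ⟨hcn, hyc⟩

/-- Erasing all letters but a repeated `x` gives a relation from `x` to a power of `x` with exponent
at least 2. Modelability extracts a context of `xx`, which balance forces to be `x`; substituting
`d` for `x` finishes. -/
theorem square_of_repeat (hR : R.Modelable) (hb : R.Balanced) {c v : List V}
    (h : R.rel (ofList c) (ofList v)) (hv : ¬ v.Nodup) (d : List V) (hd : d.Nodup) :
    R.rel (ofList d) (ofList (d ++ d)) := by
  classical
  obtain ⟨x, hx⟩ : ∃ x, 1 < v.count x := by
    by_contra! hc
    exact hv (List.nodup_iff_count_le_one.mpr hc)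
  have hxc : x ∈ c := (hb.mem_iff h x).mpr (List.count_pos_iff.mp (by omega))
  have hfm : ∀ l : List V, l.flatMap (fun y => if y = x then [x] else [])
      = List.replicate (l.count x) x := by
    intro l
    induction l with
    | nil => rfl
    | cons y l ih =>
      by_cases hyx : y = x
      · subst hyx
        simp [ih, List.replicate_succ]
      · simp [ih, hyx]
  have hx1 : R.rel (ofList [x]) (ofList [x]) := rel_refl_list (List.nodup_singleton x)
  have h1 := rel_flatMap (d := [x]) (fun y => if y = x then [x] else []) h
    (by rw [hfm, List.count_eq_one_of_mem (nodup_list h) hxc]; exact hx1)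
  obtain ⟨k, hk⟩ := Nat.exists_eq_add_of_lt hx
  -- The power is split after its second letter, so that `xx` appears as a factor.
  rw [hfm, hk, show 1 + k + 1 = 2 + k by omega, List.replicate_add] at h1
  obtain ⟨e, -, he, -⟩ := hR.append h1
  have hmem := hb.mem_iff he
  obtain rfl : e = [x] := by
    have hp : e.Perm [x] := (List.perm_ext_iff_of_nodup (nodup_list he)
      (List.nodup_singleton x)).mpr fun y => by simp [hmem]
    exact List.perm_singleton.mp hp
  have h2 := rel_flatMap (d := d) (fun _ => d) he (by simpa using rel_refl_list hd)
  simpa [List.replicate_succ] using h2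

/-- In a modelable balanced structure with terminal contexts, a context of a substitution instance
of a word is one of the corresponding instance of each context of that word. -/
theorem rel_of_rel_subst [Infinite V] (hR : R.Modelable) (hb : R.Balanced)
    (ht : R.HasTerminalContexts) {v w d : Word V} (s : V → Word V) (h : R.rel v w)
    (hd : R.rel d (Word.concat fun j => s (w.get j))) :
    R.rel d (Word.concat fun i => s (v.get i)) := by
  by_cases hw : w.Nodup
  · exact R.subst s (hb.symm hw h) hd
  · have h' : R.rel (ofList v.toList) (ofList w.toList) := by simpa using h
    have hsq := square_of_repeat hR hb h' (mt nodup_toList.mp hw)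
    -- A context `c` of `s(v)` is also one of `s(w)`, so it can be compared with `d` there.
    obtain ⟨c, hc⟩ := exists_rel_of_square hR hb hsq (Word.concat fun i => s (v.get i)).toList
    rw [ofList_toList] at hc
    exact trans (rel_contexts hb ht hd (R.subst s h hc)) hc

end ContextStructure

/-! ### The two cases of part (a) -/

theorem entails_of_balanced {σ : Signature.{u}} [Nonempty σ.Srt] {R : ContextStructure σ.Var}
    (hR : R.Modelable) (hb : R.Balanced) (ht : R.HasTerminalContexts)
    {E : Set (REquation σ R)} {φ : REquation σ R}
    (h : Entails hR (setMulticategory.{u} R.structureCategory) E φ)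
    (C : Multicategory.{v, w} R.structureCategory) : Entails hR C E φ := by
  refine entails_of_contexts (fun _ _ => True) hR h Set.univ (fun c _ n v hc => ?_)
    (fun _ _ _ => trivial) (fun s v w _ hvw c _ hc => ?_) (Set.mem_univ _) fun _ => trivial
  · obtain ⟨d, hd, hdv⟩ := hR hc
    exact ⟨d, fun _ => Set.mem_univ _, hd, hdv⟩
  · exact ContextStructure.rel_of_rel_subst hR hb ht (fun x => (s x).word) hvw hc

/-- Letters of a context need not occur in the word, so a context of `s(w)` may miss letters of
`s(v)`. Restricting to the single context of φ, and to terms with variables in it, removes the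
problem. -/
theorem entails_of_cartesian {σ : Signature.{u}} [Nonempty σ.Srt] {R : ContextStructure σ.Var}
    (hR : R.Modelable) (hc : R.IsCartesian)
    {E : Set (REquation σ R)} {φ : REquation σ R}
    (h : Entails hR (setMulticategory.{u} R.structureCategory) E φ)
    (C : Multicategory.{v, w} R.structureCategory) : Entails hR C E φ := by
  have hn : φ.ctx.Nodup := R.nodup φ.lhs_ctx
  have key : ∀ (n : ℕ) (v : Fin n → Word σ.Var),
      R.rel φ.ctx (Word.concat v) ↔ ∀ i, R.rel φ.ctx (v i) := by
    intro n v
    simp only [hc _ _, hn, true_and, Set.subset_def, Word.mem_vars_concat]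
    exact ⟨fun h i x hx => h x ⟨i, hx⟩, fun h x ⟨i, hx⟩ => h i x hx⟩
  refine entails_of_contexts (fun _ t => R.rel φ.ctx t.word) hR h {φ.ctx} ?_
    (fun f t ht => (key _ _).mpr ht) ?_ (Set.mem_singleton _) fun i => ?_
  · rintro c rfl n v hv
    exact ⟨fun _ => φ.ctx, fun _ => rfl, (key _ _).mpr fun _ => R.refl hn, (key _ _).mp hv⟩
  · rintro s v w hs - c rfl -
    exact (key _ _).mpr hs
  · refine (hc _ _).mpr ⟨hn, ?_⟩
    rintro x ⟨j, rfl⟩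
    exact ⟨i, rfl⟩

/-! ### Context structures from invariant congruences -/

/-- A congruence on the free monoid of words over `V` that is invariant under all substitutions
and relates only words with the same letters. -/
structure InvariantCongruence (V : Type u) where
  r : List V → List V → Prop
  equiv : Equivalence r
  append : ∀ {a a' b b' : List V}, r a a' → r b b' → r (a ++ b) (a' ++ b')
  flatMap : ∀ {a b : List V} (s : V → List V), r a b → r (a.flatMap s) (b.flatMap s)
  mem_iff : ∀ {a b : List V}, r a b → ∀ x, x ∈ a ↔ x ∈ b

namespace InvariantCongruence

open Word

variable {V : Type u} (T : InvariantCongruence V)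

theorem flatten {n : ℕ} {a b : Fin n → List V} (h : ∀ i, T.r (a i) (b i)) :
    T.r (List.ofFn a).flatten (List.ofFn b).flatten := by
  induction n with
  | zero => simpa using T.equiv.refl []
  | succ n ih =>
    rw [List.ofFn_succ, List.ofFn_succ, List.flatten_cons, List.flatten_cons]
    exact T.append (h 0) (ih fun i => h i.succ)

/-- The context structure relating a context to the words congruent to it. -/
def contextStructure : ContextStructure V where
  rel c v := c.Nodup ∧ T.r c.toList v.toList
  nodup h := h.1
  refl h := ⟨h, T.equiv.refl _⟩
  vars_subset h x hx := mem_toList.mp ((T.mem_iff h.2 x).mpr (mem_toList.mpr hx))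
  concat {c n v w} h hi := by
    refine ⟨h.1, T.equiv.trans h.2 ?_⟩
    rw [toList_concat, toList_concat]
    exact T.flatten fun i => (hi i).2
  subst {c v d} s h hd := by
    refine ⟨hd.1, T.equiv.trans hd.2 ?_⟩
    rw [toList_concat_get, toList_concat_get]
    exact T.flatMap _ h.2

theorem balanced : T.contextStructure.Balanced := fun h =>
  Set.ext fun x => by rw [← mem_toList, ← mem_toList, T.mem_iff h.2 x]

/-- Any context of a word is terminal, as it is congruent to the word. -/
theorem hasTerminalContexts : T.contextStructure.HasTerminalContexts := fun _ ⟨c, hc⟩ =>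
  ⟨c, hc.1, fun _ _ => ⟨fun h => ⟨h.1, T.equiv.trans h.2 hc.2⟩,
    fun h => ⟨h.1, T.equiv.trans h.2 (T.equiv.symm hc.2)⟩⟩⟩

/-- Only the existence of a context for each factor has to be supplied; congruence then makes the
concatenated contexts fit automatically. -/
theorem modelable (h : ∀ (c : List V) (L : List (List V)), c.Nodup → T.r c L.flatten →
    ∀ l ∈ L, ∃ d : List V, d.Nodup ∧ T.r d l) : T.contextStructure.Modelable := by
  intro c n v hc
  have h1 := hc.2
  rw [toList_concat] at h1
  choose d hd hdv using fun i : Fin n => h _ _ (nodup_toList.mpr hc.1) h1 (v i).toList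
    (List.mem_ofFn.mpr ⟨i, rfl⟩)
  refine ⟨fun i => ofList (d i), ⟨hc.1, T.equiv.trans hc.2 ?_⟩, fun i =>
    ⟨nodup_toList.mp (by simpa using hd i), by simpa using hdv i⟩⟩
  rw [toList_concat, toList_concat]
  exact T.flatten fun i => by simpa using T.equiv.symm (hdv i)

theorem memΔ_iff {m n : ℕ} (θ : Fin m → Fin n) : T.contextStructure.MemΔ θ ↔
    ∃ c : Fin n → V, Function.Injective c ∧ T.r (List.ofFn c) (List.ofFn fun j => c (θ j)) :=
  ⟨fun ⟨c, hc, h⟩ => ⟨c, hc, h.2⟩, fun ⟨c, hc, h⟩ => ⟨c, hc, hc, h⟩⟩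

variable (V)

/-- Equality. -/
def eq : InvariantCongruence V where
  r := Eq
  equiv := eq_equivalence
  append := by rintro _ _ _ _ rfl rfl; rfl
  flatMap := by rintro _ _ s rfl; rfl
  mem_iff := by rintro _ _ rfl x; rfl

/-- Equality up to a permutation. -/
def perm : InvariantCongruence V where
  r := List.Perm
  equiv := List.Perm.eqv V
  append := List.Perm.append
  flatMap _ h := h.flatMap_right _
  mem_iff h _ := h.mem_iff

/-- Having the same letters. -/
def sameLetters : InvariantCongruence V where
  r a b := ∀ x, x ∈ a ↔ x ∈ b
  equiv := ⟨fun _ _ => Iff.rfl, fun h x => (h x).symm, fun h h' x => (h x).trans (h' x)⟩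
  append h h' x := by simp only [List.mem_append, h x, h' x]
  flatMap s h x := by simp only [List.mem_flatMap, h]
  mem_iff h := h

variable {V}

/-- `List.dedup` keeps the last occurrence of each letter. This identity makes equality of the
results compatible with concatenation. -/
theorem dedup_append_dedup [DecidableEq V] (a b : List V) :
    (a.dedup ++ b.dedup).dedup = (a ++ b).dedup := by
  rw [List.dedup_append, List.dedup_append, List.dedup_idem]
  induction a with
  | nil => rfl
  | cons x a ih =>
    by_cases hx : x ∈ a
    · rw [List.dedup_cons_of_mem hx, ih, List.cons_union, List.insert_of_mem]
      exact List.mem_union_left hx _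
    · rw [List.dedup_cons_of_notMem hx, List.cons_union, List.cons_union, ih]

theorem dedup_flatMap_dedup [DecidableEq V] (s : V → List V) (a : List V) :
    (a.dedup.flatMap s).dedup = (a.flatMap s).dedup := by
  induction a with
  | nil => rfl
  | cons x a ih =>
    by_cases hx : x ∈ a
    · rw [List.dedup_cons_of_mem hx, ih, List.flatMap_cons, List.Subset.dedup_append_right]
      exact fun y hy => List.mem_flatMap.mpr ⟨x, hx, hy⟩
    · rw [List.dedup_cons_of_notMem hx, List.flatMap_cons, List.flatMap_cons,
        ← dedup_append_dedup, ih, dedup_append_dedup]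

variable (V)

open Classical in
/-- Having the same last occurrences of letters, in the same order. -/
noncomputable def lastOccurrences : InvariantCongruence V where
  r a b := a.dedup = b.dedup
  equiv := ⟨fun _ => rfl, fun h => h.symm, fun h h' => h.trans h'⟩
  append {a a' b b'} h h' := by
    rw [← dedup_append_dedup, h, h', dedup_append_dedup]
  flatMap s h := by rw [← dedup_flatMap_dedup, h, dedup_flatMap_dedup]
  mem_iff h x := by rw [← List.mem_dedup, h, List.mem_dedup]

variable {V}

/-- The congruence between the reversed words. -/
def reverse : InvariantCongruence V where
  r a b := T.r a.reverse b.reverse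
  equiv := ⟨fun _ => T.equiv.refl _, T.equiv.symm, T.equiv.trans⟩
  append h h' := by
    rw [List.reverse_append, List.reverse_append]
    exact T.append h' h
  flatMap s h := by
    rw [List.reverse_flatMap, List.reverse_flatMap]
    exact T.flatMap _ h
  mem_iff h x := by simpa using T.mem_iff h x

/-! ### The structure categories of the congruences -/

theorem eq_memΔ_iff [Infinite V] {m n : ℕ} (θ : Fin m → Fin n) :
    (eq V).contextStructure.MemΔ θ ↔ FinFunClass.identities m n θ := by
  rw [memΔ_iff]
  constructor
  · rintro ⟨c, hc, h⟩
    obtain rfl : n = m := by simpa using congrArg List.length h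
    exact ⟨rfl, fun i => congrArg Fin.val (hc (congrFun (List.ofFn_injective h) i)).symm⟩
  · rintro ⟨rfl, h⟩
    obtain ⟨c, hc⟩ := ContextStructure.exists_context (V := V) m
    exact ⟨c, hc, congrArg List.ofFn (funext fun i => congrArg c (Fin.ext (h i)).symm)⟩

theorem mem_ofFn_comp {m n : ℕ} {θ : Fin m → Fin n} {c : Fin n → V} (hc : Function.Injective c) :
    (∀ x, x ∈ List.ofFn c ↔ x ∈ List.ofFn fun j => c (θ j)) ↔ Function.Surjective θ := by
  simp only [List.mem_ofFn]
  constructor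
  · intro h i
    obtain ⟨j, hj⟩ := (h (c i)).mp ⟨i, rfl⟩
    exact ⟨j, hc hj⟩
  · intro h x
    constructor
    · rintro ⟨i, rfl⟩
      obtain ⟨j, rfl⟩ := h i
      exact ⟨j, rfl⟩
    · rintro ⟨j, rfl⟩
      exact ⟨θ j, rfl⟩

theorem sameLetters_memΔ_iff [Infinite V] {m n : ℕ} (θ : Fin m → Fin n) :
    (sameLetters V).contextStructure.MemΔ θ ↔ FinFunClass.surjections m n θ := by
  rw [memΔ_iff]
  constructor
  · rintro ⟨c, hc, h⟩
    exact (mem_ofFn_comp hc).mp h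
  · intro h
    obtain ⟨c, hc⟩ := ContextStructure.exists_context (V := V) n
    exact ⟨c, hc, (mem_ofFn_comp hc).mpr h⟩

theorem perm_memΔ_iff [Infinite V] {m n : ℕ} (θ : Fin m → Fin n) :
    (perm V).contextStructure.MemΔ θ ↔ FinFunClass.bijections m n θ := by
  rw [memΔ_iff]
  constructor
  · rintro ⟨c, hc, h⟩
    obtain rfl : n = m := by simpa using h.length_eq
    exact Finite.surjective_iff_bijective.mp ((mem_ofFn_comp hc).mp fun x => h.mem_iff)
  · intro h
    obtain ⟨c, hc⟩ := ContextStructure.exists_context (V := V) n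
    refine ⟨c, hc, (List.perm_ext_iff_of_nodup (List.nodup_ofFn.mpr hc)
      (List.nodup_ofFn.mpr (hc.comp h.injective))).mpr ((mem_ofFn_comp hc).mpr h.surjective)⟩

/-- The inner hypothesis says that `x` is the last position of its value. The position `y` need not
be last, since its value recurs at a last position further right. In the induction, the first entry
survives deduplication exactly when its value does not recur. -/
theorem pairwise_dedup_ofFn {n : ℕ} : ∀ {m : ℕ} (θ : Fin m → Fin n),
    (List.ofFn θ).dedup.Pairwise (· < ·) ↔
      ∀ x y, x < y → (∀ z, x < z → θ z ≠ θ x) → θ x < θ y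
  | 0, θ => by simp
  | m + 1, θ => by
    have ih := pairwise_dedup_ofFn fun i : Fin m => θ i.succ
    have hsucc : (∀ x y, x < y → (∀ z, x < z → θ z ≠ θ x) → θ x < θ y) ↔
        ((∀ i : Fin m, θ i.succ ≠ θ 0) → ∀ i : Fin m, θ 0 < θ i.succ) ∧
          ∀ x y : Fin m, x < y → (∀ z : Fin m, x < z → θ z.succ ≠ θ x.succ) →
            θ x.succ < θ y.succ := by
      simp only [Fin.forall_fin_succ, Fin.succ_lt_succ_iff, Fin.succ_pos,
        Fin.not_lt_zero, false_imp_iff, true_imp_iff, true_and]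
      grind
    rw [hsucc, ← ih, List.ofFn_succ]
    by_cases h0 : θ 0 ∈ List.ofFn fun i : Fin m => θ i.succ
    · rw [List.dedup_cons_of_mem h0]
      obtain ⟨i, hi⟩ := List.mem_ofFn.mp h0
      exact ⟨fun h => ⟨fun h' => absurd hi (h' i), h⟩, fun h => h.2⟩
    · rw [List.dedup_cons_of_notMem h0, List.pairwise_cons]
      simp only [List.mem_dedup, List.mem_ofFn, forall_exists_index,
        forall_apply_eq_imp_iff, not_exists] at h0 ⊢
      exact ⟨fun h => ⟨fun _ => h.1, h.2⟩, fun h => ⟨h.1 h0, h.2⟩⟩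

theorem exists_isGreatest_fiber {m n : ℕ} (θ : Fin m → Fin n) (x : Fin m) :
    ∃ y, x ≤ y ∧ IsGreatest (θ ⁻¹' {θ x}) y := by
  have hf : (θ ⁻¹' {θ x}).Finite := Set.toFinite _
  obtain ⟨y, hy⟩ := hf.exists_maximal ⟨x, rfl⟩
  have hg : IsGreatest (θ ⁻¹' {θ x}) y := ⟨hy.1, fun z hz => by
    rcases le_total z y with h | h
    · exact h
    · exact hy.2 hz h⟩
  exact ⟨y, hg.2 rfl, hg⟩

theorem rightSurjections_iff {m n : ℕ} (θ : Fin m → Fin n) :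
    FinFunClass.rightSurjections m n θ ↔
      (List.finRange n).dedup = (List.ofFn θ).dedup := by
  have hs : (∀ x y, x < y → (∀ z, x < z → θ z ≠ θ x) → θ x < θ y) ↔
      ∀ (i j : Fin n) (x y : Fin m), i ≤ j → IsGreatest (θ ⁻¹' {i}) x →
        IsGreatest (θ ⁻¹' {j}) y → x ≤ y := by
    constructor
    · rintro h i j x y hij ⟨rfl, hx⟩ ⟨rfl, hy⟩
      by_contra! hxy
      exact absurd (h y x hxy fun z hz he => absurd (hy he) hz.not_ge) hij.not_gt
    · intro h x y hxy hx
      by_contra! hle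
      -- The fibre condition speaks of greatest elements only, so `y` is moved to the last position
      -- of its value.
      obtain ⟨z, hz, hg⟩ := exists_isGreatest_fiber θ y
      refine absurd (h _ _ z x hle hg ⟨rfl, fun w hw => ?_⟩) (hxy.trans_le hz).not_ge
      by_contra! hlt
      exact hx w hlt hw
  have hd : (List.finRange n).dedup = List.finRange n := (List.nodup_finRange n).dedup
  have hm : Function.Surjective θ ↔ ∀ i, i ∈ (List.ofFn θ).dedup := by
    simp [Function.Surjective]
  rw [FinFunClass.rightSurjections, ← hs, ← pairwise_dedup_ofFn, hm, hd]
  constructor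
  · rintro ⟨h1, h2⟩
    -- Two strictly increasing lists with the same members coincide.
    refine List.Perm.eq_of_pairwise (le := (· < ·)) (fun a b _ _ h h' => absurd h h'.asymm)
      (List.pairwise_lt_finRange n) h2 ?_
    exact (List.perm_ext_iff_of_nodup (List.nodup_finRange n) (List.nodup_dedup _)).mpr
      fun i => by simp [h1 i, - List.mem_dedup]
  · intro h
    rw [← h]
    exact ⟨List.mem_finRange, List.pairwise_lt_finRange n⟩

theorem lastOccurrences_r_iff {m n : ℕ} (θ : Fin m → Fin n) {c : Fin n → V}
    (hc : Function.Injective c) :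
    (lastOccurrences V).r (List.ofFn c) (List.ofFn fun j => c (θ j)) ↔
      FinFunClass.rightSurjections m n θ := by
  classical
  have e1 : List.ofFn c = (List.finRange n).map c := List.ofFn_eq_map
  have e2 : (List.ofFn fun j => c (θ j)) = (List.ofFn θ).map c := by rw [List.map_ofFn]; rfl
  rw [rightSurjections_iff, e1, e2]
  refine Iff.trans ?_ (List.map_injective_iff.mpr hc).eq_iff
  rw [← List.dedup_map_of_injective hc, ← List.dedup_map_of_injective hc]
  simp only [lastOccurrences]

theorem lastOccurrences_memΔ_iff [Infinite V] {m n : ℕ} (θ : Fin m → Fin n) :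
    (lastOccurrences V).contextStructure.MemΔ θ ↔ FinFunClass.rightSurjections m n θ := by
  rw [memΔ_iff]
  constructor
  · rintro ⟨c, hc, h⟩
    exact (lastOccurrences_r_iff θ hc).mp h
  · intro h
    obtain ⟨c, hc⟩ := ContextStructure.exists_context (V := V) n
    exact ⟨c, hc, (lastOccurrences_r_iff θ hc).mpr h⟩

theorem isGreatest_rev {m n : ℕ} (θ : Fin m → Fin n) (i : Fin n) (x : Fin m) :
    IsGreatest ((fun j => (θ j.rev).rev) ⁻¹' {i}) x ↔ IsLeast (θ ⁻¹' {i.rev}) x.rev := by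
  simp only [IsGreatest, IsLeast, Set.mem_preimage, Set.mem_singleton_iff, mem_upperBounds,
    mem_lowerBounds, Fin.rev_eq_iff]
  refine and_congr Iff.rfl ⟨fun h y hy => ?_, fun h y hy => ?_⟩
  · have := h y.rev (by simpa using hy)
    exact Fin.rev_le_iff.mpr this
  · have := h y.rev hy
    exact Fin.rev_le_rev.mp this

/-- Conjugation with the order reversals exchanges greatest and least elements of fibres and
reverses both inequalities. -/
theorem rightSurjections_rev {m n : ℕ} (θ : Fin m → Fin n) :
    FinFunClass.rightSurjections m n (fun j => (θ j.rev).rev) ↔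
      FinFunClass.leftSurjections m n θ := by
  have hsurj : Function.Surjective (fun j : Fin m => (θ j.rev).rev) ↔ Function.Surjective θ := by
    have : (fun j : Fin m => (θ j.rev).rev) = Fin.revPerm ∘ θ ∘ Fin.revPerm := rfl
    rw [this, Equiv.comp_surjective, Equiv.surjective_comp]
  refine and_congr hsurj ⟨fun h i j x y hij hx hy => ?_, fun h i j x y hij hx hy => ?_⟩
  · refine Fin.rev_le_rev.mp (h j.rev i.rev y.rev x.rev (Fin.rev_le_rev.mpr hij) ?_ ?_) <;>
    simpa [isGreatest_rev]
  · exact Fin.rev_le_rev.mp (h j.rev i.rev y.rev x.rev (Fin.rev_le_rev.mpr hij)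
      ((isGreatest_rev θ j y).mp hy) ((isGreatest_rev θ i x).mp hx))

theorem reverse_lastOccurrences_memΔ_iff [Infinite V] {m n : ℕ} (θ : Fin m → Fin n) :
    (lastOccurrences V).reverse.contextStructure.MemΔ θ ↔
      FinFunClass.leftSurjections m n θ := by
  have key : ∀ c : Fin n → V, Function.Injective c →
      ((lastOccurrences V).reverse.r (List.ofFn c) (List.ofFn fun j => c (θ j)) ↔
        FinFunClass.leftSurjections m n θ) := by
    intro c hc
    have e : ∀ (k : ℕ) (f : Fin k → V), (List.ofFn f).reverse = List.ofFn fun j => f j.rev :=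
      fun k f => List.ext_getElem (by simp) fun i h1 h2 => by
        simp only [List.getElem_reverse, List.getElem_ofFn]
        exact congrArg f (Fin.ext (by simp [Fin.val_rev]; omega))
    -- Reversing both words amounts to using the reversed context `c` and the conjugate of `θ`.
    rw [← rightSurjections_rev,
      ← lastOccurrences_r_iff (c := fun i => c i.rev) _ (hc.comp Fin.rev_injective)]
    simp only [reverse, e, Fin.rev_rev]
  rw [memΔ_iff]
  constructor
  · rintro ⟨c, hc, h⟩
    exact (key c hc).mp h
  · intro h
    obtain ⟨c, hc⟩ := ContextStructure.exists_context (V := V) n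
    exact ⟨c, hc, (key c hc).mpr h⟩

end InvariantCongruence

/-! ### The cartesian structure and the six classes -/

namespace ContextStructure

open Word

/-- The cartesian context structure. -/
def cartesian (V : Type u) : ContextStructure V where
  rel c v := c.Nodup ∧ v.vars ⊆ c.vars
  nodup h := h.1
  refl h := ⟨h, subset_rfl⟩
  vars_subset h := h.2
  concat {c n v w} h hi := by
    refine ⟨h.1, fun x hx => ?_⟩
    obtain ⟨i, hx⟩ := mem_vars_concat.mp hx
    exact h.2 (mem_vars_concat.mpr ⟨i, (hi i).2 hx⟩)
  subst {c v d} s h hd := by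
    refine ⟨hd.1, fun x hx => ?_⟩
    obtain ⟨i, hx⟩ := mem_vars_concat.mp hx
    obtain ⟨j, hj⟩ := h.2 ⟨i, rfl⟩
    exact hd.2 (mem_vars_concat.mpr ⟨j, hj ▸ hx⟩)

theorem cartesian_modelable (V : Type u) : (cartesian V).Modelable := by
  intro c n v hc
  refine ⟨fun _ => c, ⟨hc.1, fun x hx => (mem_vars_concat.mp hx).choose_spec⟩, fun i =>
    ⟨hc.1, fun x hx => hc.2 (mem_vars_concat.mpr ⟨i, hx⟩)⟩⟩

theorem cartesian_memΔ {V : Type u} [Infinite V] {m n : ℕ} (θ : Fin m → Fin n) :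
    (cartesian V).MemΔ θ := by
  obtain ⟨c, hc⟩ := exists_context (V := V) n
  refine ⟨c, hc, hc, ?_⟩
  rintro _ ⟨j, rfl⟩
  exact ⟨θ j, rfl⟩

end ContextStructure

open InvariantCongruence in
theorem exists_contextStructure (V : Type u) [Infinite V] (P : FinFunClass)
    (hP : P ∈ ({FinFunClass.identities, FinFunClass.bijections,
        FinFunClass.functions, FinFunClass.surjections, FinFunClass.leftSurjections,
        FinFunClass.rightSurjections} : Set FinFunClass)) :
    ∃ R : ContextStructure V, R.Modelable ∧
        ((R.Balanced ∧ R.HasTerminalContexts) ∨ R.IsCartesian) ∧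
        ∀ (m n : ℕ) (θ : Fin m → Fin n), R.structureCategory.mem θ ↔ P m n θ := by
  classical
  -- For equality and permutation, a factor of a word without repetitions is its own context. The
  -- other congruences relate every word to a deduplicated one.
  have factor : ∀ (L : List (List V)), L.flatten.Nodup → ∀ l ∈ L, l.Nodup := fun L h l hl =>
    (List.nodup_flatten.mp h).1 l hl
  have balanced : ∀ T : InvariantCongruence V, (T.contextStructure.Balanced ∧
      T.contextStructure.HasTerminalContexts) ∨ T.contextStructure.IsCartesian := fun T =>
    Or.inl ⟨T.balanced, T.hasTerminalContexts⟩
  rcases hP with rfl | rfl | rfl | rfl | rfl | rfl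
  · exact ⟨(eq V).contextStructure,
      (eq V).modelable fun c L hc h l hl => ⟨l, factor L (h ▸ hc) l hl, rfl⟩,
      balanced _, fun m n θ => eq_memΔ_iff θ⟩
  · exact ⟨(perm V).contextStructure,
      (perm V).modelable fun c L hc h l hl =>
        ⟨l, factor L ((List.Perm.nodup_iff h).mp hc) l hl, List.Perm.refl l⟩,
      balanced _, fun m n θ => perm_memΔ_iff θ⟩
  · exact ⟨.cartesian V, ContextStructure.cartesian_modelable V, Or.inr fun _ _ => Iff.rfl,
      fun m n θ => iff_of_true (ContextStructure.cartesian_memΔ θ) trivial⟩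
  · exact ⟨(sameLetters V).contextStructure,
      (sameLetters V).modelable fun c L hc h l hl =>
        ⟨l.dedup, List.nodup_dedup l, fun x => List.mem_dedup⟩,
      balanced _, fun m n θ => sameLetters_memΔ_iff θ⟩
  · exact ⟨(lastOccurrences V).reverse.contextStructure,
      (lastOccurrences V).reverse.modelable fun c L hc h l hl =>
        ⟨l.reverse.dedup.reverse, List.nodup_reverse.mpr (List.nodup_dedup _),
          by simp [reverse, lastOccurrences]⟩,
      balanced _, fun m n θ => reverse_lastOccurrences_memΔ_iff θ⟩
  · exact ⟨(lastOccurrences V).contextStructure,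
      (lastOccurrences V).modelable fun c L hc h l hl =>
        ⟨l.dedup, List.nodup_dedup l, by simp [lastOccurrences]⟩,
      balanced _, fun m n θ => lastOccurrences_memΔ_iff θ⟩

theorem mainTheorem1 :
    (∀ (σ : Signature.{u}) [Nonempty σ.Srt] (R : ContextStructure σ.Var) (hR : R.Modelable),
      (R.Balanced ∧ R.HasTerminalContexts) ∨ R.IsCartesian →
      ∀ (E : Set (REquation σ R)) (φ : REquation σ R),
        Entails hR (setMulticategory.{u} R.structureCategory) E φ →
        ∀ C : Multicategory.{v, w} R.structureCategory, Entails hR C E φ) ∧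
    (∀ (V : Type u) [Infinite V], ∀ P ∈ ({FinFunClass.identities, FinFunClass.bijections,
        FinFunClass.functions, FinFunClass.surjections, FinFunClass.leftSurjections,
        FinFunClass.rightSurjections} : Set FinFunClass),
      ∃ R : ContextStructure V, R.Modelable ∧
        ((R.Balanced ∧ R.HasTerminalContexts) ∨ R.IsCartesian) ∧
        ∀ (m n : ℕ) (θ : Fin m → Fin n), R.structureCategory.mem θ ↔ P m n θ) :=
  ⟨fun _ _ _ hR hc _ _ h C => hc.elim (fun hb => entails_of_balanced hR hb.1 hb.2 h C)
    fun hc => entails_of_cartesian hR hc h C, exists_contextStructure⟩
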